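/- Let $\mathbb{T}=S^1\subset\mathbb{C}$ be the circle group. For a topological group $G$ let $EG=G*G*G*\cdots$ be Milnor's infinite join with its free $G$-action, $BG:=EG/G$, and for a $G$-space $Y$ let $Y_{hG}:=(EG\times Y)/G$ be the homotopy orbits (diagonal action). Let $\Lambda(S^1)=\operatorname{Map}(\mathbb{T},S^1)$ be the free loop space with the compact-open topology and the rotation action $(\lambda\cdot f)(z)=f(\lambda z)$ of $\mathbb{T}$. For $k\in\mathbb{Z}$ let $\operatorname{Map}^k(S^1,S^1)\subset\Lambda(S^1)$ be the subspace of maps of winding number $k$, and let $X_k$ be the space $S^1$ with the $\mathbb{T}$-action $\lambda\cdot\zeta:=\lambda^k\zeta$. Then: 1. Every $f\in\Lambda(S^1)$ has exactly one winding number, and the connected components of $\Lambda(S^1)$ are the subspaces $\operatorname{Map}^k(S^1,S^1)$, $k\in\mathbb{Z}$. 2. For every $k\in\mathbb{Z}$ the map $\iota_k:X_k\to\operatorname{Map}^k(S^1,S^1)$, $\iota_k(\zeta)(z)=\zeta z^k$, is a $\mathbb{T}$-equivariant embedding; it is a homotopy equivalence with homotopy inverse $f\mapsto f(1)$; and the induced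 map $(X_k)_{h\mathbb{T}}\to\operatorname{Map}^k(S^1,S^1)_{h\mathbb{T}}$ is a homotopy equivalence. 3. There is a homotopy equivalence $$\Lambda(S^1)_{h\mathbb{T}}\;\simeq\;(S^1\times BS^1)\;\amalg\coprod_{k\in\mathbb{Z}\setminus\{0\}}B(\mathbb{Z}/k\mathbb{Z})$$ which sends $\operatorname{Map}^0(S^1,S^1)_{h\mathbb{T}}$ to the summand $S^1\times BS^1$ and $\operatorname{Map}^k(S^1,S^1)_{h\mathbb{T}}$, for $k\neq 0$, to the summand $B(\mathbb{Z}/k\mathbb{Z})$ indexed by $k$. -/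

import Mathlib

open scoped ContinuousMap

noncomputable section

/-- Milnor's total space `EG`, the infinite join `G * G * G * ⋯`.  A point is a formal convex
combination `∑ᵢ tᵢ gᵢ`: a finitely supported sequence of weights `tᵢ ≥ 0` with sum `1`, together
with an element `gᵢ ∈ G` for exactly those `i` with `tᵢ ≠ 0`. -/
@[ext]
structure MilnorE (G : Type*) where
  weight : ℕ →₀ ℝ
  elt : ℕ → Option G
  weight_nonneg : ∀ i, 0 ≤ weight i
  weight_sum : (weight.sum fun _ t => t) = 1
  elt_eq_none_iff : ∀ i, elt i = none ↔ weight i = 0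

/-- Milnor's topology: the coarsest one for which every weight `tᵢ : EG → ℝ` and every partial
map `gᵢ : {tᵢ ≠ 0} → G` (with open domain) is continuous. -/
instance MilnorE.instTopologicalSpace (G : Type*) [TopologicalSpace G] :
    TopologicalSpace (MilnorE G) :=
  (⨅ i : ℕ, TopologicalSpace.induced (fun p : MilnorE G => p.weight i) inferInstance) ⊓
    TopologicalSpace.generateFrom
      {s | ∃ (i : ℕ) (U : Set G), IsOpen U ∧ s = {p : MilnorE G | ∃ g ∈ U, p.elt i = some g}}

/-- The free action of `G` on `EG`: `h • ∑ᵢ tᵢ gᵢ = ∑ᵢ tᵢ (h gᵢ)`. -/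
instance MilnorE.instMulAction (G : Type*) [Group G] : MulAction G (MilnorE G) where
  smul h p :=
    { weight := p.weight
      elt := fun i => (p.elt i).map (fun g => h * g)
      weight_nonneg := p.weight_nonneg
      weight_sum := p.weight_sum
      elt_eq_none_iff := fun i => by
        rw [Option.map_eq_none_iff]
        exact p.elt_eq_none_iff i }
  one_smul p := by
    refine MilnorE.ext rfl (funext fun i => ?_)
    change (p.elt i).map (fun g => 1 * g) = p.elt i
    simp
  mul_smul a b p := by
    refine MilnorE.ext rfl (funext fun i => ?_)
    change (p.elt i).map (fun g => a * b * g)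
      = ((p.elt i).map (fun g => b * g)).map (fun g => a * g)
    rw [Option.map_map]
    congr 1
    funext g
    exact mul_assoc a b g

/-- The homotopy orbit space (Borel construction) `Y_{hG} = (EG × Y)/G` for the diagonal action,
with the quotient topology. -/
abbrev HomotopyOrbits (G : Type*) [Group G] [TopologicalSpace G]
    (Y : Type*) [TopologicalSpace Y] [MulAction G Y] : Type _ :=
  Quotient (MulAction.orbitRel G (MilnorE G × Y))

/-- The classifying space `BG = EG/G`, with the quotient topology. -/
abbrev ClassifyingSpace (G : Type*) [Group G] [TopologicalSpace G] : Type _ :=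
  Quotient (MulAction.orbitRel G (MilnorE G))

/-- The map `Y_{hG} → Z_{hG}`, `[x, y] ↦ [x, φ y]`, induced by an equivariant continuous map. -/
def HomotopyOrbits.map {G : Type*} [Group G] [TopologicalSpace G]
    {Y Z : Type*} [TopologicalSpace Y] [MulAction G Y] [TopologicalSpace Z] [MulAction G Z]
    (φ : C(Y, Z)) (hφ : ∀ (g : G) (y : Y), φ (g • y) = g • φ y) :
    C(HomotopyOrbits G Y, HomotopyOrbits G Z) where
  toFun := Quotient.map (fun p => (p.1, φ p.2)) (by
    rintro ⟨x, y⟩ ⟨x', y'⟩ ⟨g, hg⟩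
    refine ⟨g, ?_⟩
    have h1 : g • x' = x := congrArg Prod.fst hg
    have h2 : g • y' = y := congrArg Prod.snd hg
    change (g • x', g • φ y') = (x, φ y)
    rw [← hφ, h1, h2])
  continuous_toFun := by
    refine continuous_quot_lift _ ?_
    exact continuous_quotient_mk'.comp
      (continuous_fst.prodMk (φ.continuous.comp continuous_snd))

/-- The free loop space `ΛX = Map(𝕋, X)` with the compact-open topology.  It is a separate type
because for `X = 𝕋` the type `C(Circle, X)` also carries the pointwise multiplication action. -/
def FreeLoopSpace (X : Type*) [TopologicalSpace X] : Type _ := C(Circle, X)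

instance FreeLoopSpace.instTopologicalSpace (X : Type*) [TopologicalSpace X] :
    TopologicalSpace (FreeLoopSpace X) :=
  inferInstanceAs (TopologicalSpace C(Circle, X))

instance FreeLoopSpace.instFunLike (X : Type*) [TopologicalSpace X] :
    FunLike (FreeLoopSpace X) Circle X :=
  inferInstanceAs (FunLike C(Circle, X) Circle X)

/-- The rotation action of `𝕋` on loops: `(w • f)(z) = f(w z)`. -/
instance FreeLoopSpace.instMulAction (X : Type*) [TopologicalSpace X] :
    MulAction Circle (FreeLoopSpace X) where
  smul w f := ContinuousMap.comp (f : C(Circle, X)) (ContinuousMap.mulLeft w)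
  one_smul f := by
    refine ContinuousMap.ext fun z => ?_
    change f (1 * z) = f z
    rw [one_mul]
  mul_smul a b f := by
    refine ContinuousMap.ext fun z => ?_
    change f (a * b * z) = f (b * (a * z))
    rw [← mul_assoc, mul_comm a b]

/-- A loop in the circle has winding number `k` if it lifts along `Circle.exp : ℝ → 𝕋` to a
continuous function that increases by `2πk` over every period. -/
def HasWindingNumber (f : FreeLoopSpace Circle) (k : ℤ) : Prop :=
  ∃ φ : ℝ → ℝ, Continuous φ ∧ (∀ t, f (Circle.exp t) = Circle.exp (φ t)) ∧
    ∀ t, φ (t + 2 * Real.pi) = φ t + 2 * Real.pi * k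

theorem HasWindingNumber.smul {f : FreeLoopSpace Circle} {k : ℤ} (hf : HasWindingNumber f k)
    (w : Circle) : HasWindingNumber (w • f) k := by
  obtain ⟨φ, hc, hl, hp⟩ := hf
  obtain ⟨a, rfl⟩ : ∃ a : ℝ, Circle.exp a = w := ⟨_, Circle.exp_arg w⟩
  refine ⟨fun t => φ (a + t), by fun_prop, fun t => ?_, fun t => ?_⟩
  · change f (Circle.exp a * Circle.exp t) = _
    rw [← Circle.exp_add, hl]
  · change φ (a + (t + 2 * Real.pi)) = _
    rw [← add_assoc, hp]

/-- The space `Mapᵏ(S¹, S¹)` of loops of winding number `k`, as a subspace of `Λ(S¹)`. -/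
abbrev WindingLoops (k : ℤ) : Type := {f : FreeLoopSpace Circle // HasWindingNumber f k}

/-- Rotation of loops restricts to loops of winding number `k`. -/
instance WindingLoops.instMulAction (k : ℤ) : MulAction Circle (WindingLoops k) where
  smul w f := ⟨w • f.1, f.2.smul w⟩
  one_smul f := Subtype.ext (one_smul Circle f.1)
  mul_smul a b f := Subtype.ext (mul_smul a b f.1)

/-- The space `X_k`: the circle. -/
def RotationCircle (_k : ℤ) : Type := Circle

instance RotationCircle.instTopologicalSpace (k : ℤ) : TopologicalSpace (RotationCircle k) :=
  inferInstanceAs (TopologicalSpace Circle)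

/-- The `k`-fold rotation action on `X_k`: `w • ζ = wᵏ ζ`. -/
instance RotationCircle.instMulAction (k : ℤ) : MulAction Circle (RotationCircle k) where
  smul w ζ := (w ^ k * (show Circle from ζ) : Circle)
  one_smul ζ := by
    change (1 : Circle) ^ k * (show Circle from ζ) = ζ
    rw [one_zpow, one_mul]
  mul_smul a b ζ := by
    change (a * b) ^ k * (show Circle from ζ) = a ^ k * (b ^ k * (show Circle from ζ))
    rw [mul_zpow, mul_assoc]

/-- The constant-speed loop `z ↦ ζ zᵏ`. -/
def constantSpeedLoop (k : ℤ) (ζ : Circle) : FreeLoopSpace Circle :=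
  (⟨fun z => ζ * z ^ k, continuous_const.mul (continuous_zpow k)⟩ : C(Circle, Circle))

theorem hasWindingNumber_constantSpeedLoop (k : ℤ) (ζ : Circle) :
    HasWindingNumber (constantSpeedLoop k ζ) k := by
  obtain ⟨a, rfl⟩ : ∃ a : ℝ, Circle.exp a = ζ := ⟨_, Circle.exp_arg ζ⟩
  refine ⟨fun t => a + k * t, by fun_prop, fun t => ?_, fun t => ?_⟩
  · change Circle.exp a * Circle.exp t ^ k = _
    rw [Circle.exp_add, ← Circle.exp_zsmul, zsmul_eq_mul]
  · ring

/-- The map `ι_k : X_k → Mapᵏ(S¹, S¹)` sending `ζ` to the constant-speed loop `z ↦ ζ zᵏ`. -/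
def constantSpeed (k : ℤ) : C(RotationCircle k, WindingLoops k) where
  toFun ζ := ⟨constantSpeedLoop k ζ, hasWindingNumber_constantSpeedLoop k ζ⟩
  continuous_toFun := by
    refine Continuous.subtype_mk ?_ _
    let F : C(Circle × Circle, Circle) :=
      ⟨fun p => p.1 * p.2 ^ k, continuous_fst.mul (continuous_snd.zpow k)⟩
    exact F.curry.continuous

theorem constantSpeed_smul (k : ℤ) (w : Circle) (ζ : RotationCircle k) :
    constantSpeed k (w • ζ) = w • constantSpeed k ζ := by
  refine Subtype.ext (ContinuousMap.ext fun z => ?_)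
  change w ^ k * (show Circle from ζ) * z ^ k = (show Circle from ζ) * (w * z) ^ k
  rw [mul_zpow, mul_comm (w ^ k), mul_assoc]

end

/-! A loop of winding number `k` has the form `z ^ k * Circle.exp (g z)` with `g` a continuous real
function on the circle, unique up to a constant in `2πℤ`. The parametrization `twistedExp k` by the
vector space `C(Circle, ℝ)` is open, because `arcsin` supplies local logarithms
(`isOpenMap_twistedExp`). So the loops of winding number `k` form an open connected set; these sets
partition the loop space and are therefore its components.

In the coordinate `g`, loops contract along straight lines to constants, that is, to constant-speed
loops. Contracting to `g 1` makes evaluation at `1` the homotopy inverse. Contracting to the mean of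
`g` commutes with rotation and so passes to homotopy orbits. Such homotopies are built upstairs and
pushed down along open quotient maps (`exists_homotopyEquiv_of_isOpenQuotientMap`).

For `k = 0` the action on the circle is trivial and the homotopy orbits are a product. For `k ≠ 0`
it is transitive with stabilizer the cyclic group `C` of order `|k|`, so the homotopy orbits are `ET
/ C`, with `T` the circle. To compare this with `EC / C`, equivariant maps are needed both ways
(`exists_equivariant_maps_milnorE`): `EC → ET` comes from the inclusion, and `ET → EC` from a
partition of unity on two open sets over which `z ↦ z ^ |k|` is trivial. Both composites are
equivariantly homotopic to the identity by Milnor's argument (`homotopicWith_of_equivariant`): move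
two maps to disjoint join coordinates, then join them linearly. -/

noncomputable section

/-! ### Weighted families: partial points of the join, whose masses need not add up to `1` -/

/-- A finitely supported family of nonnegative weights on `ℕ`, with an element of `G` at each
index of nonzero weight.  The points of `MilnorE G` are those of total weight `1`. -/
@[ext]
structure WeightedFamily (G : Type*) where
  weight : ℕ →₀ ℝ
  elt : ℕ → Option G
  weight_nonneg : ∀ i, 0 ≤ weight i
  elt_eq_none_iff : ∀ i, elt i = none ↔ weight i = 0

namespace WeightedFamily

variable {G H Z : Type*}

/-- The total weight. -/
def total (p : WeightedFamily G) : ℝ := p.weight.sum fun _ t => t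

/-- The union of two families; where both are supported, the first one wins. -/
def add (p q : WeightedFamily G) : WeightedFamily G where
  weight := p.weight + q.weight
  elt i := (p.elt i).or (q.elt i)
  weight_nonneg i := add_nonneg (p.weight_nonneg i) (q.weight_nonneg i)
  elt_eq_none_iff i := by
    rw [Option.or_eq_none_iff, p.elt_eq_none_iff, q.elt_eq_none_iff, Finsupp.add_apply,
      add_eq_zero_iff_of_nonneg (p.weight_nonneg i) (q.weight_nonneg i)]

open Classical in
/-- Reindexing along an injection. -/
def shift (σ : ℕ ↪ ℕ) (p : WeightedFamily G) : WeightedFamily G where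
  weight := p.weight.embDomain σ
  elt := Function.extend σ p.elt fun _ => none
  weight_nonneg j := by
    by_cases h : ∃ i, σ i = j
    · obtain ⟨i, rfl⟩ := h
      rw [Finsupp.embDomain_apply_self]
      exact p.weight_nonneg i
    · rw [Finsupp.embDomain_of_notMem_range _ _ _ (by simpa using h)]
  elt_eq_none_iff j := by
    by_cases h : ∃ i, σ i = j
    · obtain ⟨i, rfl⟩ := h
      rw [Finsupp.embDomain_apply_self, σ.injective.extend_apply]
      exact p.elt_eq_none_iff i
    · rw [Finsupp.embDomain_of_notMem_range _ _ _ (by simpa using h), Function.extend_apply' _ _ _ h]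
      simp

/-- The factor by which `reweigh u c` multiplies the weight at `i`. -/
def factor (u : ℕ → G → ℝ) (p : WeightedFamily G) (i : ℕ) : ℝ :=
  (p.elt i).elim 0 (u i)

/-- Multiply the weight at `i` by a nonnegative function of `i` and of the element at `i`, and
apply a map to the elements that keep a nonzero weight. -/
def reweigh (u : ℕ → G → ℝ) (hu : ∀ i g, 0 ≤ u i g) (c : G → H) (p : WeightedFamily G) :
    WeightedFamily H where
  weight := Finsupp.onFinset p.weight.support (fun i => p.weight i * p.factor u i)
    fun i hi => by
      rw [Finsupp.mem_support_iff]
      exact left_ne_zero_of_mul hi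
  elt i := ((p.elt i).filter fun g => u i g ≠ 0).map c
  weight_nonneg i := by
    refine mul_nonneg (p.weight_nonneg i) ?_
    rw [factor]
    cases p.elt i with
    | none => exact le_rfl
    | some g => exact hu i g
  elt_eq_none_iff i := by
    rw [Finsupp.onFinset_apply, Option.map_eq_none_iff, factor, mul_eq_zero, ← p.elt_eq_none_iff]
    cases p.elt i <;> simp

theorem total_add (p q : WeightedFamily G) : (p.add q).total = p.total + q.total :=
  Finsupp.sum_add_index' (fun _ => rfl) fun _ _ _ => rfl

theorem total_shift (σ : ℕ ↪ ℕ) (p : WeightedFamily G) : (p.shift σ).total = p.total :=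
  Finsupp.sum_embDomain

theorem total_reweigh (u : ℕ → G → ℝ) (hu : ∀ i g, 0 ≤ u i g) (c : G → H)
    (p : WeightedFamily G) :
    (p.reweigh u hu c).total = ∑ i ∈ p.weight.support, p.weight i * p.factor u i :=
  Finsupp.onFinset_sum (fun i hi => by
    rw [Finsupp.mem_support_iff]
    exact left_ne_zero_of_mul hi) fun _ => rfl

theorem weight_mul_factor_of_forall_eq {u : ℕ → G → ℝ} (p : WeightedFamily G) {i : ℕ} {a : ℝ}
    (hu : ∀ g, u i g = a) : p.weight i * p.factor u i = p.weight i * a := by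
  rw [factor]
  cases h : p.elt i with
  | none => simp [(p.elt_eq_none_iff i).1 h]
  | some g => simp [hu]

theorem total_reweigh_const {u : ℕ → G → ℝ} {hu : ∀ i g, 0 ≤ u i g} {c : G → H} {a : ℝ}
    (p : WeightedFamily G) (ha : ∀ i g, u i g = a) : (p.reweigh u hu c).total = p.total * a := by
  rw [total_reweigh, total, Finsupp.sum, Finset.sum_mul]
  exact Finset.sum_congr rfl fun i _ => p.weight_mul_factor_of_forall_eq (ha i)

theorem total_reweigh_add_total_reweigh {u v : ℕ → G → ℝ} {hu : ∀ i g, 0 ≤ u i g}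
    {hv : ∀ i g, 0 ≤ v i g} {c d : G → H} (p : WeightedFamily G)
    (huv : ∀ i g, u i g + v i g = 1) :
    (p.reweigh u hu c).total + (p.reweigh v hv d).total = p.total := by
  rw [total_reweigh, total_reweigh, ← Finset.sum_add_distrib, total, Finsupp.sum]
  refine Finset.sum_congr rfl fun i _ => ?_
  rw [← mul_add, factor, factor]
  cases h : p.elt i with
  | none => simp [(p.elt_eq_none_iff i).1 h]
  | some g => simp [huv]

theorem shift_elt_apply (σ : ℕ ↪ ℕ) (p : WeightedFamily G) (i : ℕ) :
    (p.shift σ).elt (σ i) = p.elt i :=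
  σ.injective.extend_apply p.elt (fun _ => none) i

theorem shift_weight_apply (σ : ℕ ↪ ℕ) (p : WeightedFamily G) (i : ℕ) :
    (p.shift σ).weight (σ i) = p.weight i := Finsupp.embDomain_apply_self _ _ _

theorem shift_elt_of_notMem (σ : ℕ ↪ ℕ) (p : WeightedFamily G) {j : ℕ} (h : ¬∃ i, σ i = j) :
    (p.shift σ).elt j = none :=
  Function.extend_apply' p.elt (fun _ => none) j h

theorem shift_weight_of_notMem (σ : ℕ ↪ ℕ) (p : WeightedFamily G) {j : ℕ}
    (h : ¬∃ i, σ i = j) : (p.shift σ).weight j = 0 :=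
  Finsupp.embDomain_of_notMem_range _ _ _ (by simpa using h)

/-- The map on families induced by a map on elements. -/
def map (c : G → H) (p : WeightedFamily G) : WeightedFamily H where
  weight := p.weight
  elt i := (p.elt i).map c
  weight_nonneg := p.weight_nonneg
  elt_eq_none_iff i := by rw [Option.map_eq_none_iff, p.elt_eq_none_iff]

theorem map_add (c : G → H) (p q : WeightedFamily G) :
    (p.add q).map c = (p.map c).add (q.map c) :=
  WeightedFamily.ext rfl (funext fun i => by
    change ((p.elt i).or (q.elt i)).map c = ((p.elt i).map c).or ((q.elt i).map c)
    cases p.elt i <;> rfl)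

theorem map_shift (c : G → H) (σ : ℕ ↪ ℕ) (p : WeightedFamily G) :
    (p.shift σ).map c = (p.map c).shift σ :=
  WeightedFamily.ext rfl (funext fun j => by
    by_cases h : ∃ i, σ i = j
    · obtain ⟨i, rfl⟩ := h
      rw [shift_elt_apply]
      exact congrArg (Option.map c) (shift_elt_apply σ p i)
    · rw [shift_elt_of_notMem _ _ h]
      exact congrArg (Option.map c) (shift_elt_of_notMem σ p h))

/-- Naturality of `reweigh`: the source of the equivariance of the constructions on `EG` below. -/
theorem reweigh_map {K L : Type*} {u : ℕ → G → ℝ} {hu : ∀ i g, 0 ≤ u i g} {v : ℕ → H → ℝ}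
    {hv : ∀ i g, 0 ≤ v i g} {a : G → H} {b : H → L} {c : G → K} {d : K → L}
    (huv : ∀ i g, v i (a g) = u i g) (h : ∀ g, b (a g) = d (c g)) (p : WeightedFamily G) :
    (p.map a).reweigh v hv b = (p.reweigh u hu c).map d := by
  refine WeightedFamily.ext (Finsupp.ext fun i => ?_) (funext fun i => ?_)
  · change p.weight i * ((p.elt i).map a).elim 0 (v i) = p.weight i * (p.elt i).elim 0 (u i)
    cases p.elt i with
    | none => rfl
    | some g => simp [huv]
  · change (((p.elt i).map a).filter fun g => v i g ≠ 0).map b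
      = (((p.elt i).filter fun g => u i g ≠ 0).map c).map d
    cases p.elt i with
    | none => rfl
    | some g => by_cases hg : u i g = 0 <;> simp [Option.filter, huv, hg, h]

theorem reweigh_one {u : ℕ → G → ℝ} {hu : ∀ i g, 0 ≤ u i g} (h : ∀ i g, u i g = 1)
    (c : G → H) (p : WeightedFamily G) : p.reweigh u hu c = p.map c := by
  refine WeightedFamily.ext (Finsupp.ext fun i => ?_) (funext fun i => ?_)
  · exact (p.weight_mul_factor_of_forall_eq (h i)).trans (mul_one _)
  · change ((p.elt i).filter fun g => u i g ≠ 0).map c = (p.elt i).map c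
    cases p.elt i <;> simp [h]

theorem reweigh_map_of_const {u : ℕ → ℝ} (hu : ∀ i, 0 ≤ u i) (a : G → H)
    (p : WeightedFamily G) :
    (p.map a).reweigh (fun i _ => u i) (fun i _ => hu i) id
      = (p.reweigh (fun i _ => u i) (fun i _ => hu i) id).map a :=
  reweigh_map (c := id) (d := a) (b := id) (fun _ _ => rfl) (fun _ => rfl) p

theorem weight_eq_zero_of_total_eq_zero {p : WeightedFamily G} (h : p.total = 0) (i : ℕ) :
    p.weight i = 0 := by
  by_contra hi
  exact hi ((Finset.sum_eq_zero_iff_of_nonneg fun j _ => p.weight_nonneg j).1 h i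
    (Finsupp.mem_support_iff.2 hi))

theorem add_of_total_eq_zero (p : WeightedFamily G) {q : WeightedFamily G} (h : q.total = 0) :
    p.add q = p := by
  refine WeightedFamily.ext (Finsupp.ext fun i => ?_) (funext fun i => ?_)
  · exact (congrArg _ (weight_eq_zero_of_total_eq_zero h i)).trans (add_zero _)
  · change (p.elt i).or (q.elt i) = p.elt i
    rw [(q.elt_eq_none_iff i).2 (weight_eq_zero_of_total_eq_zero h i), Option.or_none]

theorem add_of_total_eq_zero_left {p : WeightedFamily G} (q : WeightedFamily G)
    (h : p.total = 0) : p.add q = q := by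
  refine WeightedFamily.ext (Finsupp.ext fun i => ?_) (funext fun i => ?_)
  · exact (congrArg (· + q.weight i) (weight_eq_zero_of_total_eq_zero h i)).trans (zero_add _)
  · change (p.elt i).or (q.elt i) = q.elt i
    rw [(p.elt_eq_none_iff i).2 (weight_eq_zero_of_total_eq_zero h i), Option.none_or]

theorem map_id (p : WeightedFamily G) : p.map id = p :=
  WeightedFamily.ext rfl (funext fun _ => Option.map_id_apply)

/-- Continuity of a parametrized weighted family, in the sense of Milnor's topology. -/
structure IsCts [TopologicalSpace G] [TopologicalSpace Z] (f : Z → WeightedFamily G) : Prop where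
  weight : ∀ i, Continuous fun z => (f z).weight i
  elt : ∀ i (U : Set G), IsOpen U → IsOpen {z | ∃ g ∈ U, (f z).elt i = some g}

/-! ### Continuity of parametrized families -/

section Continuity

variable [TopologicalSpace G] [TopologicalSpace H] [TopologicalSpace Z]

/-- Disjointness of supports is essential: at a shared index the element would jump from that of `q`
to that of `p` as soon as the weight of `p` becomes nonzero. -/
theorem IsCts.add {p q : Z → WeightedFamily G} (hp : IsCts p) (hq : IsCts q)
    (hd : ∀ z i, (p z).weight i = 0 ∨ (q z).weight i = 0) : IsCts fun z => (p z).add (q z) where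
  weight i := (hp.weight i).add (hq.weight i)
  elt i U hU := by
    convert (hp.elt i U hU).union (hq.elt i U hU) using 1
    ext z
    simp only [Set.mem_ofPred_eq, Set.mem_union]
    change (∃ g ∈ U, ((p z).elt i).or ((q z).elt i) = some g) ↔ _
    rcases hd z i with h | h
    · simp [((p z).elt_eq_none_iff i).2 h]
    · simp [((q z).elt_eq_none_iff i).2 h]

theorem IsCts.shift {p : Z → WeightedFamily G} (hp : IsCts p) (σ : ℕ ↪ ℕ) :
    IsCts fun z => (p z).shift σ where
  weight j := by
    by_cases h : ∃ i, σ i = j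
    · obtain ⟨i, rfl⟩ := h
      simpa only [shift_weight_apply] using hp.weight i
    · simpa only [shift_weight_of_notMem _ _ h] using continuous_const
  elt j U hU := by
    by_cases h : ∃ i, σ i = j
    · obtain ⟨i, rfl⟩ := h
      simpa only [shift_elt_apply] using hp.elt i U hU
    · simp [shift_elt_of_notMem _ _ h]

theorem IsCts.isOpen_elt_prod {p : Z → WeightedFamily G} (hp : IsCts p) (i : ℕ)
    {S : Set (Z × G)} (hS : IsOpen S) : IsOpen {z | ∃ g, (z, g) ∈ S ∧ (p z).elt i = some g} := by
  refine isOpen_iff_mem_nhds.2 fun z₀ ⟨g₀, hg₀, he⟩ => ?_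
  obtain ⟨V, W, hV, hW, hz, hg, hVW⟩ := isOpen_prod_iff.1 hS z₀ g₀ hg₀
  filter_upwards [hV.mem_nhds hz, (hp.elt i W hW).mem_nhds ⟨g₀, hg, he⟩] with z hz ⟨g, hgW, hge⟩
  exact ⟨g, hVW ⟨hz, hgW⟩, hge⟩

/-- The map `c` has to be continuous only where the new weight survives, so locally defined maps are
admitted, such as branches of a root. -/
theorem IsCts.reweigh {p : Z → WeightedFamily G} (hp : IsCts p) {u : Z → ℕ → G → ℝ}
    (hu : ∀ z i g, 0 ≤ u z i g) (hu1 : ∀ z i g, u z i g ≤ 1)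
    (huc : ∀ i, Continuous fun x : Z × G => u x.1 i x.2) {c : G → H}
    (hc : ∀ i (U : Set H), IsOpen U → IsOpen {x : Z × G | u x.1 i x.2 ≠ 0 ∧ c x.2 ∈ U}) :
    IsCts fun z => (p z).reweigh (u z) (hu z) c where
  weight i := by
    change Continuous fun z => (p z).weight i * (p z).factor (u z) i
    refine continuous_iff_continuousAt.2 fun z₀ => ?_
    cases h : (p z₀).elt i with
    | none =>
      have h0 := ((p z₀).elt_eq_none_iff i).1 h
      rw [ContinuousAt, h0, zero_mul]
      -- Where the element is absent the factor may oscillate, but it is at most `1` and the weight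
      -- tends to `0`.
      refine squeeze_zero (fun z => ((p z).reweigh (u z) (hu z) c).weight_nonneg i)
        (fun z => ?_) (h0 ▸ (hp.weight i).tendsto z₀)
      refine mul_le_of_le_one_right ((p z).weight_nonneg i) ?_
      rw [factor]
      cases (p z).elt i with
      | none => exact zero_le_one
      | some g => exact hu1 z i g
    | some g₀ =>
      refine (hp.weight i).continuousAt.mul ?_
      have h0 : (p z₀).factor (u z₀) i = u z₀ i g₀ := by rw [factor, h]; rfl
      rw [ContinuousAt, h0]
      refine tendsto_nhds.2 fun V hV hm => ?_
      filter_upwards [(hp.isOpen_elt_prod i (hV.preimage (huc i))).mem_nhds ⟨g₀, hm, h⟩]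
        with z ⟨g, hg, he⟩
      change (p z).factor (u z) i ∈ V
      rw [factor, he]
      exact hg
  elt i U hU := by
    convert hp.isOpen_elt_prod i (hc i U hU) using 1
    ext z
    simp only [Set.mem_ofPred_eq]
    change (∃ g ∈ U, (((p z).elt i).filter fun g => u z i g ≠ 0).map c = some g) ↔ _
    cases (p z).elt i with
    | none => simp
    | some g => by_cases h : u z i g = 0 <;> simp [Option.filter, h]

end Continuity

end WeightedFamily

/-! ### Milnor's space: universal property, shifts and joins -/

namespace MilnorE

open WeightedFamily

variable {G H Z : Type*}

/-- The weighted family underlying a point of `EG`. -/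
def toFamily (p : MilnorE G) : WeightedFamily G where
  weight := p.weight
  elt := p.elt
  weight_nonneg := p.weight_nonneg
  elt_eq_none_iff := p.elt_eq_none_iff

/-- The point of `EG` given by a weighted family of total weight `1`. -/
def ofFamily (p : WeightedFamily G) (h : p.total = 1) : MilnorE G where
  weight := p.weight
  elt := p.elt
  weight_nonneg := p.weight_nonneg
  weight_sum := h
  elt_eq_none_iff := p.elt_eq_none_iff

theorem total_toFamily (p : MilnorE G) : p.toFamily.total = 1 := p.weight_sum

theorem toFamily_injective : Function.Injective (toFamily : MilnorE G → WeightedFamily G) :=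
  fun _ _ h => MilnorE.ext (congrArg WeightedFamily.weight h) (congrArg WeightedFamily.elt h)

theorem continuous_iff [TopologicalSpace G] [TopologicalSpace Z] {f : Z → MilnorE G} :
    Continuous f ↔ IsCts fun z => (f z).toFamily := by
  refine (continuous_inf_rng.trans (continuous_iInf_rng.and continuous_generateFrom_iff)).trans ?_
  constructor
  · rintro ⟨h1, h2⟩
    exact ⟨fun i => continuous_induced_rng.1 (h1 i), fun i U hU => h2 _ ⟨i, U, hU, rfl⟩⟩
  · rintro ⟨h1, h2⟩
    refine ⟨fun i => continuous_induced_rng.2 (h1 i), ?_⟩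
    rintro _ ⟨i, U, hU, rfl⟩
    exact h2 i U hU

theorem isCts_toFamily [TopologicalSpace G] :
    IsCts (toFamily : MilnorE G → WeightedFamily G) :=
  continuous_iff.1 continuous_id

theorem isCts_toFamily_comp [TopologicalSpace G] [TopologicalSpace Z] {f : Z → MilnorE G}
    (hf : Continuous f) : IsCts fun z => (f z).toFamily :=
  continuous_iff.1 hf

instance [Group G] [TopologicalSpace G] [ContinuousMul G] : ContinuousSMul G (MilnorE G) where
  continuous_smul := by
    refine continuous_iff.2 ⟨fun i => ?_, fun i U hU => ?_⟩
    · change Continuous fun z : G × MilnorE G => z.2.toFamily.weight i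
      exact (isCts_toFamily.weight i).comp continuous_snd
    have h : IsCts fun z : G × MilnorE G => z.2.toFamily := isCts_toFamily_comp continuous_snd
    have hS : IsOpen {x : (G × MilnorE G) × G | x.1.1 * x.2 ∈ U} := hU.preimage (by fun_prop)
    convert h.isOpen_elt_prod i hS using 1
    ext ⟨a, p⟩
    change (∃ g ∈ U, (p.elt i).map (a * ·) = some g) ↔ ∃ g, a * g ∈ U ∧ p.elt i = some g
    cases p.elt i <;> simp

/-- Reindexing the join coordinates along an injection. -/
def shift (σ : ℕ ↪ ℕ) (p : MilnorE G) : MilnorE G :=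
  ofFamily (p.toFamily.shift σ) (by rw [total_shift, total_toFamily])

theorem continuous_shift [TopologicalSpace G] (σ : ℕ ↪ ℕ) :
    Continuous (shift σ : MilnorE G → MilnorE G) :=
  continuous_iff.2 (isCts_toFamily.shift σ)

/-- The portion of the mass at index `i` that has moved at time `s`: it leaves at time
`1 / (i + 2)` and has arrived at time `1 / (i + 1)`. -/
def moved (i : ℕ) (s : ℝ) : ℝ := max 0 (min 1 ((i + 1) * ((i + 2) * s - 1)))

theorem moved_nonneg (i : ℕ) (s : ℝ) : 0 ≤ moved i s := le_max_left _ _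

theorem moved_le_one (i : ℕ) (s : ℝ) : moved i s ≤ 1 := max_le zero_le_one (min_le_left _ _)

theorem continuous_moved (i : ℕ) : Continuous (moved i) := by
  unfold moved
  fun_prop

theorem moved_zero (i : ℕ) : moved i 0 = 0 := by
  refine max_eq_left (min_le_of_right_le ?_)
  have : (0 : ℝ) ≤ i := i.cast_nonneg
  linarith

theorem moved_one (i : ℕ) : moved i 1 = 1 := by
  have : (0 : ℝ) ≤ i := i.cast_nonneg
  rw [moved, min_eq_left (by nlinarith), max_eq_right zero_le_one]

/-- High indices move first: once the mass at `i` has started, `(i + 2) s ≥ 1`, hence `(j + 1) s ≥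
1` and the mass at `j` has arrived. -/
theorem moved_eq_one_or_moved_eq_zero {i j : ℕ} (h : i + 1 ≤ j) (s : ℝ) :
    moved j s = 1 ∨ moved i s = 0 := by
  have hi : (0 : ℝ) ≤ i := i.cast_nonneg
  have hij : (i : ℝ) + 1 ≤ j := by exact_mod_cast h
  rcases le_total ((i + 2) * s) 1 with hs | hs
  · right
    exact max_eq_left (min_le_of_right_le (mul_nonpos_of_nonneg_of_nonpos (by linarith)
      (by linarith)))
  · left
    have hs0 : 0 < s := by
      by_contra h0
      nlinarith
    have h1 : 1 ≤ (j + 1) * s := hs.trans (mul_le_mul_of_nonneg_right (by linarith) hs0.le)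
    rw [moved, min_eq_left (by nlinarith), max_eq_right zero_le_one]

/-- The point at time `s` of the deformation of the identity of `EG` to `shift σ`. -/
def move (σ : ℕ ↪ ℕ) (s : ℝ) (p : MilnorE G) : MilnorE G :=
  ofFamily ((p.toFamily.reweigh (fun i _ => 1 - moved i s)
      (fun i _ => sub_nonneg.2 (moved_le_one i s)) id).add
    ((p.toFamily.reweigh (fun i _ => moved i s) (fun i _ => moved_nonneg i s) id).shift σ)) (by
    rw [total_add, total_shift, total_reweigh_add_total_reweigh _ (by simp), total_toFamily])

theorem move_zero (σ : ℕ ↪ ℕ) (p : MilnorE G) : p.move σ 0 = p := by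
  refine toFamily_injective ((add_of_total_eq_zero _ ?_).trans ?_)
  · rw [total_shift, total_reweigh_const _ fun i _ => moved_zero i, mul_zero]
  · rw [reweigh_one (by simp [moved_zero]), map_id]

theorem move_one (σ : ℕ ↪ ℕ) (p : MilnorE G) : p.move σ 1 = p.shift σ := by
  refine toFamily_injective ((add_of_total_eq_zero_left _ ?_).trans ?_)
  · rw [total_reweigh_const (a := 0) _ (by simp [moved_one]), mul_zero]
  · rw [reweigh_one (by simp [moved_one]), map_id]
    rfl

theorem move_smul [Group G] (σ : ℕ ↪ ℕ) (s : ℝ) (a : G) (p : MilnorE G) :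
    (a • p).move σ s = a • p.move σ s := by
  refine toFamily_injective (Eq.trans ?_ (map_add (a * ·) _ _).symm)
  rw [map_shift, ← reweigh_map_of_const (fun i => sub_nonneg.2 (moved_le_one i s)),
    ← reweigh_map_of_const fun i => moved_nonneg i s]
  rfl

theorem isOpen_setOf_ne_and_mem [TopologicalSpace G] [TopologicalSpace Z] {u : Z → ℝ}
    (hu : Continuous u) {U : Set G} (hU : IsOpen U) :
    IsOpen {x : Z × G | u x.1 ≠ 0 ∧ id x.2 ∈ U} :=
  (isOpen_ne_fun (hu.comp continuous_fst) continuous_const).inter (hU.preimage continuous_snd)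

theorem continuous_move [TopologicalSpace G] [TopologicalSpace Z] (σ : ℕ ↪ ℕ)
    (hσ : ∀ i, i + 1 ≤ σ i) {s : Z → ℝ} (hs : Continuous s) {p : Z → MilnorE G}
    (hp : Continuous p) : Continuous fun z => (p z).move σ (s z) := by
  have h : IsCts fun z => (p z).toFamily := isCts_toFamily_comp hp
  have hm (i : ℕ) : Continuous fun z => moved i (s z) := (continuous_moved i).comp hs
  refine continuous_iff.2 (IsCts.add (h.reweigh (u := fun z i _ => 1 - moved i (s z))
      (fun z i _ => sub_nonneg.2 (moved_le_one i (s z)))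
      (fun z i _ => sub_le_self _ (moved_nonneg i (s z)))
      (fun i => continuous_const.sub ((hm i).comp continuous_fst))
      fun i U hU => isOpen_setOf_ne_and_mem (continuous_const.sub (hm i)) hU)
    ((h.reweigh (u := fun z i _ => moved i (s z)) (fun z i _ => moved_nonneg i (s z))
      (fun z i _ => moved_le_one i (s z)) (fun i => (hm i).comp continuous_fst)
      fun i U hU => isOpen_setOf_ne_and_mem (hm i) hU).shift σ) fun z j => ?_)
  by_cases hj : ∃ i, σ i = j
  · obtain ⟨i, rfl⟩ := hj
    rw [shift_weight_apply]
    -- Slot `σ i` is vacated before anything arrives from `i`, which keeps the two summands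
    -- disjoint.
    refine (moved_eq_one_or_moved_eq_zero (hσ i) (s z)).imp (fun h0 => ?_) fun h0 => ?_
    · exact (weight_mul_factor_of_forall_eq _ fun _ => by rw [h0, sub_self]).trans (mul_zero _)
    · exact (weight_mul_factor_of_forall_eq _ fun _ => h0).trans (mul_zero _)
  · exact Or.inr (shift_weight_of_notMem _ _ hj)

/-- The convex combination of two points after moving them to disjoint join coordinates. -/
def join (σ τ : ℕ ↪ ℕ) (s : unitInterval) (p q : MilnorE G) : MilnorE G :=
  ofFamily (((p.toFamily.reweigh (fun _ _ => 1 - (s : ℝ)) (fun _ _ => sub_nonneg.2 s.2.2)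
      id).shift σ).add
    ((q.toFamily.reweigh (fun _ _ => (s : ℝ)) (fun _ _ => s.2.1) id).shift τ)) (by
    rw [total_add, total_shift, total_shift, total_reweigh_const _ fun _ _ => rfl,
      total_reweigh_const _ fun _ _ => rfl, total_toFamily, total_toFamily]
    ring)

theorem join_zero (σ τ : ℕ ↪ ℕ) (p q : MilnorE G) : join σ τ 0 p q = p.shift σ := by
  refine toFamily_injective ((add_of_total_eq_zero _ ?_).trans ?_)
  · rw [total_shift, total_reweigh_const (a := 0) _ (by simp), mul_zero]
  · rw [reweigh_one (by simp), map_id]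
    rfl

theorem join_one (σ τ : ℕ ↪ ℕ) (p q : MilnorE G) : join σ τ 1 p q = q.shift τ := by
  refine toFamily_injective ((add_of_total_eq_zero_left _ ?_).trans ?_)
  · rw [total_shift, total_reweigh_const (a := 0) _ (by simp), mul_zero]
  · rw [reweigh_one (by simp), map_id]
    rfl

theorem join_smul [Group G] (σ τ : ℕ ↪ ℕ) (s : unitInterval) (a : G) (p q : MilnorE G) :
    join σ τ s (a • p) (a • q) = a • join σ τ s p q := by
  refine toFamily_injective (Eq.trans ?_ (map_add (a * ·) _ _).symm)
  rw [map_shift, map_shift, ← reweigh_map_of_const fun _ => sub_nonneg.2 s.2.2,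
    ← reweigh_map_of_const fun _ => s.2.1]
  rfl

theorem shift_weight_eq_zero_or {σ τ : ℕ ↪ ℕ} (h : ∀ i j, σ i ≠ τ j) (p q : WeightedFamily G)
    (i : ℕ) : (p.shift σ).weight i = 0 ∨ (q.shift τ).weight i = 0 := by
  by_cases hi : ∃ j, σ j = i
  · obtain ⟨j, rfl⟩ := hi
    exact Or.inr (shift_weight_of_notMem _ _ fun ⟨l, hl⟩ => h j l hl.symm)
  · exact Or.inl (shift_weight_of_notMem _ _ hi)

theorem continuous_join [TopologicalSpace G] [TopologicalSpace Z] {σ τ : ℕ ↪ ℕ}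
    (h : ∀ i j, σ i ≠ τ j) {s : Z → unitInterval} (hs : Continuous s) {p q : Z → MilnorE G}
    (hp : Continuous p) (hq : Continuous q) :
    Continuous fun z => join σ τ (s z) (p z) (q z) := by
  have hs' : Continuous fun z => (s z : ℝ) := by fun_prop
  exact continuous_iff.2 (IsCts.add
    (((isCts_toFamily_comp hp).reweigh (u := fun z _ _ => 1 - (s z : ℝ))
      (fun z _ _ => sub_nonneg.2 (s z).2.2)
      (fun z _ _ => sub_le_self _ (s z).2.1)
      (fun i => continuous_const.sub (hs'.comp continuous_fst))
      fun i U hU => isOpen_setOf_ne_and_mem (continuous_const.sub hs') hU).shift σ)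
    (((isCts_toFamily_comp hq).reweigh (u := fun z _ _ => (s z : ℝ)) (fun z _ _ => (s z).2.1)
      (fun z _ _ => (s z).2.2) (fun i => hs'.comp continuous_fst)
      fun i U hU => isOpen_setOf_ne_and_mem hs' hU).shift τ)
    fun z => shift_weight_eq_zero_or h _ _)

/-- The injection `i ↦ 2 i + c`. -/
def stride (c : ℕ) : ℕ ↪ ℕ := ⟨fun i => 2 * i + c, fun i j h => by
  have : 2 * i + c = 2 * j + c := h
  omega⟩

theorem stride_one_ne_stride_two (i j : ℕ) : stride 1 i ≠ stride 2 j := by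
  change 2 * i + 1 ≠ 2 * j + 2
  omega

/-! ### Uniqueness of equivariant maps into `EG` up to homotopy -/

section Homotopy

variable [Group G] [TopologicalSpace G] {Y ι : Type*} [TopologicalSpace Y]

theorem homotopicWith_shift {A : ι → Y → Y} {B : ι → G} (f : C(Y, MilnorE G))
    (hf : ∀ a y, f (A a y) = B a • f y) (σ : ℕ ↪ ℕ) (hσ : ∀ i, i + 1 ≤ σ i) :
    ContinuousMap.HomotopicWith f ((⟨shift σ, continuous_shift σ⟩ : C(MilnorE G, MilnorE G)).comp f)
      (fun h => ∀ a y, h (A a y) = B a • h y) := by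
  have hc : Continuous fun z : unitInterval × Y => (f z.2).move σ z.1 :=
    continuous_move σ hσ (continuous_subtype_val.comp continuous_fst)
      (f.continuous.comp continuous_snd)
  have h0 (y : Y) : (f y).move σ ((0 : unitInterval) : ℝ) = f y := by
    rw [Set.Icc.coe_zero, move_zero]
  have h1 (y : Y) : (f y).move σ ((1 : unitInterval) : ℝ) = (f y).shift σ := by
    rw [Set.Icc.coe_one, move_one]
  have hs (s : unitInterval) (a : ι) (y : Y) :
      (f (A a y)).move σ s = B a • (f y).move σ s := by
    rw [hf, move_smul]
  exact ⟨⟨⟨⟨_, hc⟩, h0, h1⟩, hs⟩⟩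

/-- Any two equivariant maps into `EG` are equivariantly homotopic. -/
theorem homotopicWith_of_equivariant {A : ι → Y → Y} {B : ι → G} {f₀ f₁ : C(Y, MilnorE G)}
    (h₀ : ∀ a y, f₀ (A a y) = B a • f₀ y) (h₁ : ∀ a y, f₁ (A a y) = B a • f₁ y) :
    ContinuousMap.HomotopicWith f₀ f₁ (fun h => ∀ a y, h (A a y) = B a • h y) := by
  -- The targets are the odd slots and the positive even slots. The offsets are `1` and `2` because
  -- `i + 1 ≤ σ i` is needed; `2 * i` fails this at `i = 0`.
  refine (homotopicWith_shift f₀ h₀ (stride 1) fun i => ?_).trans (.trans ⟨?_⟩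
    (homotopicWith_shift f₁ h₁ (stride 2) fun i => ?_).symm)
  · change i + 1 ≤ 2 * i + 1
    omega
  · exact
    { toFun := fun z => join (stride 1) (stride 2) z.1 (f₀ z.2) (f₁ z.2)
      continuous_toFun := continuous_join stride_one_ne_stride_two continuous_fst
        (f₀.continuous.comp continuous_snd) (f₁.continuous.comp continuous_snd)
      map_zero_left := fun y => join_zero _ _ _ _
      map_one_left := fun y => join_one _ _ _ _
      prop' := fun s a y => by
        change join (stride 1) (stride 2) s (f₀ (A a y)) (f₁ (A a y)) = B a • join _ _ s _ _
        rw [h₀, h₁, join_smul] }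
  · change i + 1 ≤ 2 * i + 2
    omega

end Homotopy

/-! ### Maps between Milnor spaces of different groups -/

/-- The map on Milnor spaces induced by a map of groups. -/
def map (c : G → H) (p : MilnorE G) : MilnorE H :=
  ofFamily (p.toFamily.map c) p.weight_sum

theorem continuous_map [TopologicalSpace G] [TopologicalSpace H] {c : G → H}
    (hc : Continuous c) : Continuous (map c) := by
  refine continuous_iff.2 ⟨isCts_toFamily.weight, fun i U hU => ?_⟩
  convert isCts_toFamily.elt i _ (hU.preimage hc) using 1
  ext p
  change (∃ g ∈ U, (p.elt i).map c = some g) ↔ ∃ g, c g ∈ U ∧ p.elt i = some g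
  cases p.elt i <;> simp

theorem map_smul [Group G] [Group H] (c : G →* H) (a : G) (p : MilnorE G) :
    (a • p).map c = c a • p.map c := by
  refine MilnorE.ext rfl (funext fun i => ?_)
  change ((p.elt i).map (a * ·)).map c = ((p.elt i).map c).map (c a * ·)
  cases p.elt i <;> simp

/-- The map `EG → EH` that splits each join coordinate in two along a partition of unity
`u + v = 1` of `G`, and applies `c` to the first part and `d` to the second. -/
def split (u v : G → ℝ) (hu : ∀ g, 0 ≤ u g) (hv : ∀ g, 0 ≤ v g) (huv : ∀ g, u g + v g = 1)
    (c d : G → H) (p : MilnorE G) : MilnorE H :=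
  ofFamily (((p.toFamily.reweigh (fun _ => u) (fun _ => hu) c).shift (stride 1)).add
    ((p.toFamily.reweigh (fun _ => v) (fun _ => hv) d).shift (stride 2))) (by
    rw [total_add, total_shift, total_shift,
      total_reweigh_add_total_reweigh _ (fun _ => huv), total_toFamily])

theorem continuous_split [TopologicalSpace G] [TopologicalSpace H] {u v : G → ℝ}
    {hu : ∀ g, 0 ≤ u g} {hv : ∀ g, 0 ≤ v g} {huv : ∀ g, u g + v g = 1} {c d : G → H}
    (huc : Continuous u) (hvc : Continuous v)
    (hc : ∀ U, IsOpen U → IsOpen {g | u g ≠ 0 ∧ c g ∈ U})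
    (hd : ∀ U, IsOpen U → IsOpen {g | v g ≠ 0 ∧ d g ∈ U}) :
    Continuous (split u v hu hv huv c d) :=
  continuous_iff.2 (IsCts.add
    ((isCts_toFamily.reweigh (u := fun _ _ => u) (fun _ _ => hu)
      (fun _ _ g => by linarith [hv g, huv g])
      (fun _ => huc.comp continuous_snd) fun _ U hU => (hc U hU).preimage continuous_snd).shift _)
    ((isCts_toFamily.reweigh (u := fun _ _ => v) (fun _ _ => hv)
      (fun _ _ g => by linarith [hu g, huv g])
      (fun _ => hvc.comp continuous_snd) fun _ U hU => (hd U hU).preimage continuous_snd).shift _)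
    fun _ => shift_weight_eq_zero_or stride_one_ne_stride_two _ _)

theorem split_smul [Group G] [Group H] {u v : G → ℝ} {hu : ∀ g, 0 ≤ u g} {hv : ∀ g, 0 ≤ v g}
    {huv : ∀ g, u g + v g = 1} {c d : G → H} {a : G} {b : H} (hua : ∀ g, u (a * g) = u g)
    (hva : ∀ g, v (a * g) = v g) (hc : ∀ g, c (a * g) = b * c g)
    (hd : ∀ g, d (a * g) = b * d g) (p : MilnorE G) :
    split u v hu hv huv c d (a • p) = b • split u v hu hv huv c d p := by
  refine toFamily_injective (Eq.trans ?_ (map_add (b * ·) _ _).symm)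
  rw [map_shift, map_shift,
    ← reweigh_map (a := (a * ·)) (hv := fun _ => hu) (b := c) (fun _ => hua) hc,
    ← reweigh_map (a := (a * ·)) (hv := fun _ => hv) (b := d) (fun _ => hva) hd]
  rfl

end MilnorE

/-! ### Descent of homotopies along open quotient maps -/

section Descent

variable {E₁ E₂ B₁ B₂ : Type*} [TopologicalSpace E₁] [TopologicalSpace E₂] [TopologicalSpace B₁]
  [TopologicalSpace B₂]

theorem IsOpenQuotientMap.exists_continuousMap_comp_eq {q : E₁ → B₁} (hq : IsOpenQuotientMap q)
    (f : C(E₁, B₂)) (hf : ∀ x y, q x = q y → f x = f y) : ∃ g : C(B₁, B₂), ∀ x, g (q x) = f x := by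
  let π : C(E₁, B₁) := ⟨q, hq.continuous⟩
  have hπ : Topology.IsQuotientMap π := hq.isQuotientMap
  exact ⟨hπ.lift f hf, DFunLike.congr_fun (hπ.lift_comp f hf)⟩

/-- A homotopy through fibre-respecting maps descends along an open quotient map. -/
theorem ContinuousMap.HomotopicWith.homotopic_of_isOpenQuotientMap {q₁ : E₁ → B₁} {q₂ : E₂ → B₂}
    (h₁ : IsOpenQuotientMap q₁) (h₂ : Continuous q₂) {f g : C(E₁, E₂)}
    (H : ContinuousMap.HomotopicWith f g fun h => ∀ x y, q₁ x = q₁ y → q₂ (h x) = q₂ (h y))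
    {f' g' : C(B₁, B₂)} (hf : ∀ x, f' (q₁ x) = q₂ (f x)) (hg : ∀ x, g' (q₁ x) = q₂ (g x)) :
    ContinuousMap.Homotopic f' g' := by
  obtain ⟨F⟩ := H
  -- An arbitrary set-theoretic section suffices: the class of `F (s, r b)` does not depend on the
  -- choice.
  let r (b : B₁) : E₁ := Function.surjInv h₁.surjective b
  have hr (b : B₁) : q₁ (r b) = b := Function.surjInv_eq h₁.surjective b
  have hK (s : unitInterval) (x : E₁) : q₂ (F (s, r (q₁ x))) = q₂ (F (s, x)) :=
    F.prop s _ _ (hr _)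
  refine ⟨⟨⟨fun z => q₂ (F (z.1, r z.2)), ?_⟩, fun b => ?_, fun b => ?_⟩⟩
  · rw [← (IsOpenQuotientMap.id.prodMap h₁).continuous_comp_iff]
    exact (h₂.comp F.continuous).congr fun z => (hK z.1 z.2).symm
  · change q₂ (F (0, r b)) = f' b
    rw [F.apply_zero, ← hf, hr]
  · change q₂ (F (1, r b)) = g' b
    rw [F.apply_one, ← hg, hr]

/-- A homotopy equivalence through fibre-respecting maps descends along open quotient maps. -/
theorem exists_homotopyEquiv_of_isOpenQuotientMap {q₁ : E₁ → B₁} {q₂ : E₂ → B₂}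
    (h₁ : IsOpenQuotientMap q₁) (h₂ : IsOpenQuotientMap q₂) (φ : C(E₁, E₂)) (ψ : C(E₂, E₁))
    (hφ : ∀ x y, q₁ x = q₁ y → q₂ (φ x) = q₂ (φ y))
    (hψ : ∀ x y, q₂ x = q₂ y → q₁ (ψ x) = q₁ (ψ y))
    (H₁ : ContinuousMap.HomotopicWith (ψ.comp φ) (.id E₁)
      fun h => ∀ x y, q₁ x = q₁ y → q₁ (h x) = q₁ (h y))
    (H₂ : ContinuousMap.HomotopicWith (φ.comp ψ) (.id E₂)
      fun h => ∀ x y, q₂ x = q₂ y → q₂ (h x) = q₂ (h y)) :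
    ∃ e : B₁ ≃ₕ B₂, (∀ x, e.toFun (q₁ x) = q₂ (φ x)) ∧ ∀ y, e.invFun (q₂ y) = q₁ (ψ y) := by
  obtain ⟨a, ha⟩ := h₁.exists_continuousMap_comp_eq ⟨_, h₂.continuous.comp φ.continuous⟩ hφ
  obtain ⟨b, hb⟩ := h₂.exists_continuousMap_comp_eq ⟨_, h₁.continuous.comp ψ.continuous⟩ hψ
  refine ⟨⟨a, b, H₁.homotopic_of_isOpenQuotientMap h₁ h₁.continuous (fun x => ?_) fun _ => rfl,
    H₂.homotopic_of_isOpenQuotientMap h₂ h₂.continuous (fun x => ?_) fun _ => rfl⟩, ha, hb⟩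
  · rw [ContinuousMap.comp_apply, ha]
    exact hb _
  · rw [ContinuousMap.comp_apply, hb]
    exact ha _

end Descent

/-! ### Homotopy equivalences of coproducts -/

section Coproducts

variable {X Y : Type*} [TopologicalSpace X] [TopologicalSpace Y]

/-- Viewing a homotopy as a map into the path space reduces gluing over a coproduct to the universal
property of the coproduct. -/
theorem ContinuousMap.homotopic_of_continuous_path {f g : C(X, Y)}
    (F : X → C(unitInterval, Y)) (hF : Continuous F) (h0 : ∀ x, F x 0 = f x)
    (h1 : ∀ x, F x 1 = g x) : ContinuousMap.Homotopic f g :=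
  ⟨⟨⟨fun z => F z.2 z.1, by fun_prop⟩, h0, h1⟩⟩

theorem ContinuousMap.Homotopic.exists_continuous_path {f g : C(X, Y)}
    (h : ContinuousMap.Homotopic f g) :
    ∃ F : X → C(unitInterval, Y), Continuous F ∧ (∀ x, F x 0 = f x) ∧ ∀ x, F x 1 = g x := by
  obtain ⟨H⟩ := h
  exact ⟨fun x => (H.toContinuousMap.comp ContinuousMap.prodSwap).curry x,
    ContinuousMap.continuous _, H.apply_zero, H.apply_one⟩

theorem ContinuousMap.homotopic_sum {X₁ X₂ : Type*} [TopologicalSpace X₁] [TopologicalSpace X₂]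
    {f g : C(X₁ ⊕ X₂, Y)}
    (hl : (f.comp ⟨Sum.inl, continuous_inl⟩).Homotopic (g.comp ⟨Sum.inl, continuous_inl⟩))
    (hr : (f.comp ⟨Sum.inr, continuous_inr⟩).Homotopic (g.comp ⟨Sum.inr, continuous_inr⟩)) :
    f.Homotopic g := by
  obtain ⟨F, hF, hF0, hF1⟩ := hl.exists_continuous_path
  obtain ⟨G, hG, hG0, hG1⟩ := hr.exists_continuous_path
  exact ContinuousMap.homotopic_of_continuous_path (Sum.elim F G) (hF.sumElim hG)
    (Sum.rec hF0 hG0) (Sum.rec hF1 hG1)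

theorem ContinuousMap.homotopic_sigma {ι : Type*} {X : ι → Type*} [∀ i, TopologicalSpace (X i)]
    {f g : C(Σ i, X i, Y)}
    (h : ∀ i, (f.comp (ContinuousMap.sigmaMk i)).Homotopic (g.comp (ContinuousMap.sigmaMk i))) :
    f.Homotopic g := by
  choose F hF hF0 hF1 using fun i => (h i).exists_continuous_path
  exact ContinuousMap.homotopic_of_continuous_path (fun x => F x.1 x.2) (continuous_sigma hF)
    (fun x => hF0 x.1 x.2) fun x => hF1 x.1 x.2

/-- A coproduct of two homotopy equivalences. -/
def ContinuousMap.HomotopyEquiv.sumCongr {X₁ X₂ Y₁ Y₂ : Type*} [TopologicalSpace X₁]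
    [TopologicalSpace X₂] [TopologicalSpace Y₁] [TopologicalSpace Y₂] (e : X₁ ≃ₕ Y₁)
    (f : X₂ ≃ₕ Y₂) : (X₁ ⊕ X₂) ≃ₕ (Y₁ ⊕ Y₂) where
  toFun := ⟨Sum.map e.toFun f.toFun, e.toFun.continuous.sumMap f.toFun.continuous⟩
  invFun := ⟨Sum.map e.invFun f.invFun, e.invFun.continuous.sumMap f.invFun.continuous⟩
  left_inv := ContinuousMap.homotopic_sum
    (((ContinuousMap.Homotopic.refl ⟨Sum.inl, continuous_inl⟩).comp e.left_inv))
    (((ContinuousMap.Homotopic.refl ⟨Sum.inr, continuous_inr⟩).comp f.left_inv))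
  right_inv := ContinuousMap.homotopic_sum
    (((ContinuousMap.Homotopic.refl ⟨Sum.inl, continuous_inl⟩).comp e.right_inv))
    (((ContinuousMap.Homotopic.refl ⟨Sum.inr, continuous_inr⟩).comp f.right_inv))

/-- A coproduct of a family of homotopy equivalences. -/
def ContinuousMap.HomotopyEquiv.sigmaCongr {ι : Type*} {X Y : ι → Type*}
    [∀ i, TopologicalSpace (X i)] [∀ i, TopologicalSpace (Y i)] (e : ∀ i, X i ≃ₕ Y i) :
    (Σ i, X i) ≃ₕ (Σ i, Y i) where
  toFun := ⟨fun x => ⟨x.1, (e x.1).toFun x.2⟩,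
    continuous_sigma fun i => continuous_sigmaMk.comp (e i).toFun.continuous⟩
  invFun := ⟨fun x => ⟨x.1, (e x.1).invFun x.2⟩,
    continuous_sigma fun i => continuous_sigmaMk.comp (e i).invFun.continuous⟩
  left_inv := ContinuousMap.homotopic_sigma fun i =>
    (ContinuousMap.Homotopic.refl (ContinuousMap.sigmaMk i)).comp (e i).left_inv
  right_inv := ContinuousMap.homotopic_sigma fun i =>
    (ContinuousMap.Homotopic.refl (ContinuousMap.sigmaMk i)).comp (e i).right_inv

end Coproducts

/-! ### Logarithmic coordinates and winding numbers -/

/-- The loop `z ↦ zᵏ exp(i g(z))`. -/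
def twistedExp (k : ℤ) (g : C(Circle, ℝ)) : FreeLoopSpace Circle :=
  (⟨fun z => z ^ k * Circle.exp (g z), by fun_prop⟩ : C(Circle, Circle))

theorem twistedExp_apply (k : ℤ) (g : C(Circle, ℝ)) (z : Circle) :
    twistedExp k g z = z ^ k * Circle.exp (g z) := rfl

theorem FreeLoopSpace.continuous_mul_inv :
    Continuous fun p : FreeLoopSpace Circle × FreeLoopSpace Circle =>
      (show C(Circle, Circle) from p.1) * (show C(Circle, Circle) from p.2)⁻¹ := by
  change Continuous fun p : C(Circle, Circle) × C(Circle, Circle) => p.1 * p.2⁻¹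
  fun_prop

theorem continuous_twistedExp (k : ℤ) : Continuous (twistedExp k) := by
  let F : C(C(Circle, ℝ) × Circle, Circle) :=
    ⟨fun p => p.2 ^ k * Circle.exp (p.1 p.2), by fun_prop⟩
  exact F.curry.continuous

theorem Circle.exp_arcsin_im {z : Circle} (h : 0 ≤ (z : ℂ).re) :
    Circle.exp (Real.arcsin (z : ℂ).im) = z := by
  conv_rhs => rw [← Circle.exp_arg z]
  rw [Complex.arg_of_re_nonneg h, Circle.norm_coe, div_one]

theorem twistedExp_add (k : ℤ) (g h : C(Circle, ℝ)) (z : Circle) :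
    twistedExp k (g + h) z = twistedExp k g z * Circle.exp (h z) := by
  rw [twistedExp_apply, twistedExp_apply, ContinuousMap.add_apply, Circle.exp_add, mul_assoc]

/-- Near each `twistedExp k g` there is a continuous local section through `g`: correct `g` by the
logarithm of the quotient of the two loops, which is an arcsine while that quotient stays in the
right half plane. -/
theorem isOpenMap_twistedExp (k : ℤ) : IsOpenMap (twistedExp k) := by
  refine isOpenMap_iff_nhds_le.2 fun g => ?_
  let d (f : FreeLoopSpace Circle) : C(Circle, Circle) :=
    (show C(Circle, Circle) from f) * (show C(Circle, Circle) from twistedExp k g)⁻¹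
  have hd : Continuous d := FreeLoopSpace.continuous_mul_inv.comp (Continuous.prodMk_left _)
  have hd1 : d (twistedExp k g) = 1 := mul_inv_cancel _
  let a : C(Circle, ℝ) := ⟨fun z => Real.arcsin (z : ℂ).im, by fun_prop⟩
  let s (f : FreeLoopSpace Circle) : C(Circle, ℝ) := g + a.comp (d f)
  have hs : Continuous s := continuous_const.add ((ContinuousMap.continuous_postcomp a).comp hd)
  have hsg : s (twistedExp k g) = g := by
    refine ContinuousMap.ext fun z => ?_
    change g z + Real.arcsin ((d (twistedExp k g) z : Circle) : ℂ).im = g z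
    rw [hd1]
    simp
  -- Compactness of the circle makes this condition open in the compact-open topology.
  have hV : IsOpen {f | Set.MapsTo (d f) Set.univ {z : Circle | 0 < (z : ℂ).re}} :=
    (ContinuousMap.isOpen_setOfPred_mapsTo isCompact_univ
      (isOpen_lt continuous_const (by fun_prop))).preimage hd
  intro U hU
  have hU' : s ⁻¹' (twistedExp k ⁻¹' U) ∈ nhds (twistedExp k g) :=
    hs.continuousAt.preimage_mem_nhds (by rwa [hsg])
  filter_upwards [hU', hV.mem_nhds (fun z _ => by rw [hd1]; simp)] with f hf hfV
  suffices twistedExp k (s f) = f by rwa [← this]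
  refine ContinuousMap.ext fun z => ?_
  change twistedExp k (g + a.comp (d f)) z = f z
  rw [twistedExp_add]
  change _ * Circle.exp (Real.arcsin (d f z : ℂ).im) = _
  rw [Circle.exp_arcsin_im (hfV (Set.mem_univ z)).le]
  change _ * (f z * (twistedExp k g z)⁻¹) = _
  rw [mul_comm, inv_mul_cancel_right]

theorem hasWindingNumber_twistedExp (k : ℤ) (g : C(Circle, ℝ)) :
    HasWindingNumber (twistedExp k g) k := by
  refine ⟨fun t => k * t + g (Circle.exp t), by fun_prop, fun t => ?_, fun t => ?_⟩
  · rw [twistedExp_apply, Circle.exp_add, ← Circle.exp_zsmul, zsmul_eq_mul]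
  · dsimp only
    rw [Circle.exp_add_two_pi]
    ring

theorem Circle.isOpenQuotientMap_exp : IsOpenQuotientMap Circle.exp :=
  ⟨Circle.exp_surjective, Circle.exp.continuous, isLocalHomeomorph_circleExp.isOpenMap⟩

theorem hasWindingNumber_iff {f : FreeLoopSpace Circle} {k : ℤ} :
    HasWindingNumber f k ↔ ∃ g, twistedExp k g = f := by
  refine ⟨?_, ?_⟩
  · rintro ⟨φ, hc, hl, hp⟩
    -- Removing the linear growth from the lift leaves a periodic function, which descends to the
    -- circle.
    have hper : Function.Periodic (fun t => φ t - k * t) (2 * Real.pi) := fun t => by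
      change φ (t + 2 * Real.pi) - k * (t + 2 * Real.pi) = φ t - k * t
      rw [hp]
      ring
    obtain ⟨g, hg⟩ := Circle.isOpenQuotientMap_exp.exists_continuousMap_comp_eq
      ⟨fun t => φ t - k * t, by fun_prop⟩ fun a b hab => by
        obtain ⟨m, rfl⟩ := Circle.exp_eq_exp.1 hab
        exact hper.int_mul m b
    refine ⟨g, ContinuousMap.ext fun z => ?_⟩
    obtain ⟨t, rfl⟩ := Circle.exp_surjective z
    change twistedExp k g (Circle.exp t) = f (Circle.exp t)
    rw [twistedExp_apply, hg, hl, ← Circle.exp_zsmul, ← Circle.exp_add, zsmul_eq_mul]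
    congr 1
    change k * t + (φ t - k * t) = φ t
    ring
  · rintro ⟨g, rfl⟩
    exact hasWindingNumber_twistedExp k g

/-- The multiple of `2π` is read off at one point; uniqueness of lifts along a covering propagates
it. -/
theorem Circle.exists_eq_add_of_exp_comp_eq {X : Type*} [TopologicalSpace X] [PreconnectedSpace X]
    [Nonempty X] {φ ψ : X → ℝ} (hφ : Continuous φ) (hψ : Continuous ψ)
    (h : ∀ x, Circle.exp (φ x) = Circle.exp (ψ x)) :
    ∃ m : ℤ, ∀ x, φ x = ψ x + m * (2 * Real.pi) := by
  obtain ⟨x₀⟩ := ‹Nonempty X›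
  obtain ⟨m, hm⟩ := Circle.exp_eq_exp.1 (h x₀)
  refine ⟨m, congrFun (Circle.isCoveringMap_exp.eq_of_comp_eq hφ
    (hψ.add continuous_const) (funext fun x => ?_) x₀ hm)⟩
  change Circle.exp (φ x) = Circle.exp (ψ x + m * (2 * Real.pi))
  rw [h, Circle.exp_add, Circle.exp_int_mul_two_pi, mul_one]

theorem existsUnique_hasWindingNumber (f : FreeLoopSpace Circle) :
    ∃! k : ℤ, HasWindingNumber f k := by
  refine existsUnique_of_exists_of_unique ?_ ?_
  · let F : C(ℝ, Circle) := (show C(Circle, Circle) from f).comp Circle.exp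
    obtain ⟨e₀, he₀⟩ := Circle.exp_surjective (F 0)
    obtain ⟨φ, ⟨-, hφ⟩, -⟩ := Circle.isCoveringMap_exp.existsUnique_continuousMap_lifts F 0 e₀ he₀
    have hl (t : ℝ) : f (Circle.exp t) = Circle.exp (φ t) := (congrFun hφ t).symm
    -- The lift and its translate by a period lift the same map; their difference is the winding
    -- number.
    obtain ⟨k, hk⟩ := Circle.exists_eq_add_of_exp_comp_eq
      (φ := fun t => φ (t + 2 * Real.pi)) (ψ := φ) (by fun_prop) (by fun_prop) fun t => by
        rw [← hl, ← hl, Circle.exp_add_two_pi]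
    exact ⟨k, φ, φ.continuous, hl, fun t => (hk t).trans (by ring)⟩
  · rintro k l ⟨φ, hφc, hφl, hφp⟩ ⟨ψ, hψc, hψl, hψp⟩
    obtain ⟨m, hm⟩ := Circle.exists_eq_add_of_exp_comp_eq hφc hψc fun t => by rw [← hφl, hψl]
    have h1 := hφp 0
    have h2 := hψp 0
    rw [hm, hm 0, h2] at h1
    have h3 : 2 * Real.pi * (l : ℝ) = 2 * Real.pi * k := by linarith
    exact_mod_cast (mul_left_cancel₀ Real.two_pi_pos.ne' h3).symm

theorem setOf_hasWindingNumber_eq_range (k : ℤ) :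
    {f : FreeLoopSpace Circle | HasWindingNumber f k} = Set.range (twistedExp k) :=
  Set.ext fun _ => hasWindingNumber_iff

theorem isOpen_setOf_hasWindingNumber (k : ℤ) :
    IsOpen {f : FreeLoopSpace Circle | HasWindingNumber f k} := by
  rw [setOf_hasWindingNumber_eq_range]
  exact (isOpenMap_twistedExp k).isOpen_range

theorem isClopen_setOf_hasWindingNumber (k : ℤ) :
    IsClopen {f : FreeLoopSpace Circle | HasWindingNumber f k} := by
  refine ⟨⟨?_⟩, isOpen_setOf_hasWindingNumber k⟩
  convert isOpen_iUnion fun l : {l : ℤ // l ≠ k} => isOpen_setOf_hasWindingNumber l.1 using 1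
  ext f
  obtain ⟨l, hl, hu⟩ := existsUnique_hasWindingNumber f
  simp only [Set.mem_compl_iff, Set.mem_ofPred_eq, Set.mem_iUnion, Subtype.exists, exists_prop]
  refine ⟨fun h => ⟨l, fun h' => h (h' ▸ hl), hl⟩, ?_⟩
  rintro ⟨m, hm, hfm⟩ hfk
  exact hm ((hu m hfm).trans (hu k hfk).symm)

/-- The level set is clopen, and it is connected as a continuous image of a real vector space. -/
theorem connectedComponent_eq_setOf_hasWindingNumber {k : ℤ} {f : FreeLoopSpace Circle}
    (hf : HasWindingNumber f k) :
    connectedComponent f = {g : FreeLoopSpace Circle | HasWindingNumber g k} := by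
  refine ((isClopen_setOf_hasWindingNumber k).connectedComponent_subset hf).antisymm ?_
  refine IsPreconnected.subset_connectedComponent ?_ hf
  rw [setOf_hasWindingNumber_eq_range]
  exact isPreconnected_range (continuous_twistedExp k)

/-- The map `twistedExp k` onto the space of loops of winding number `k`. -/
def twistedExpOnto (k : ℤ) (g : C(Circle, ℝ)) : WindingLoops k :=
  ⟨twistedExp k g, hasWindingNumber_twistedExp k g⟩

theorem isOpenQuotientMap_twistedExpOnto (k : ℤ) : IsOpenQuotientMap (twistedExpOnto k) where
  surjective f := by
    obtain ⟨g, hg⟩ := hasWindingNumber_iff.1 f.2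
    exact ⟨g, Subtype.ext hg⟩
  continuous := (continuous_twistedExp k).subtype_mk _
  isOpenMap := (isOpenMap_twistedExp k).subtype_mk _

theorem smul_twistedExpOnto (k : ℤ) (θ : ℝ) (g : C(Circle, ℝ)) :
    Circle.exp θ • twistedExpOnto k g = twistedExpOnto k
      (g.comp (ContinuousMap.mulLeft (Circle.exp θ)) + ContinuousMap.const _ (k * θ)) := by
  refine Subtype.ext (ContinuousMap.ext fun z => ?_)
  change (Circle.exp θ * z) ^ k * Circle.exp (g (Circle.exp θ * z))
    = z ^ k * Circle.exp (g (Circle.exp θ * z) + k * θ)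
  rw [mul_zpow, ← Circle.exp_zsmul, zsmul_eq_mul, Circle.exp_add]
  simp only [mul_comm, mul_left_comm]

theorem twistedExpOnto_eq_iff {k : ℤ} {g h : C(Circle, ℝ)} :
    twistedExpOnto k g = twistedExpOnto k h ↔
      ∃ m : ℤ, g = h + ContinuousMap.const _ (m * (2 * Real.pi)) := by
  constructor
  · intro hgh
    have h1 (z : Circle) : Circle.exp (g z) = Circle.exp (h z) := by
      have h2 : twistedExp k g z = twistedExp k h z :=
        congrArg (fun f : WindingLoops k => f.1 z) hgh
      exact mul_left_cancel h2
    obtain ⟨m, hm⟩ := Circle.exists_eq_add_of_exp_comp_eq g.continuous h.continuous h1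
    exact ⟨m, ContinuousMap.ext hm⟩
  · rintro ⟨m, rfl⟩
    refine Subtype.ext (ContinuousMap.ext fun z => ?_)
    change twistedExp k _ z = twistedExp k h z
    rw [twistedExp_add, ContinuousMap.const_apply, Circle.exp_int_mul_two_pi, mul_one]

/-! ### The rotation-invariant mean -/

/-- The mean value of a function on the circle. -/
def circleMean (g : C(Circle, ℝ)) : ℝ :=
  (2 * Real.pi)⁻¹ * ∫ t in (0 : ℝ)..(2 * Real.pi), g (Circle.exp t)

theorem continuous_circleMean : Continuous circleMean := by
  refine continuous_const.mul ?_
  exact intervalIntegral.continuous_parametric_intervalIntegral_of_continuous'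
    (f := fun (g : C(Circle, ℝ)) (t : ℝ) => g (Circle.exp t)) (by fun_prop) _ _

theorem circleMean_add_const (g : C(Circle, ℝ)) (c : ℝ) :
    circleMean (g + ContinuousMap.const _ c) = circleMean g + c := by
  simp only [circleMean, ContinuousMap.add_apply, ContinuousMap.const_apply]
  rw [intervalIntegral.integral_add (Continuous.intervalIntegrable (by fun_prop) _ _)
    (Continuous.intervalIntegrable (by fun_prop) _ _), intervalIntegral.integral_const, mul_add,
    sub_zero, smul_eq_mul, inv_mul_cancel_left₀ Real.two_pi_pos.ne']

theorem circleMean_const (c : ℝ) : circleMean (ContinuousMap.const _ c) = c := by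
  simp only [circleMean, ContinuousMap.const_apply]
  rw [intervalIntegral.integral_const, sub_zero, smul_eq_mul,
    inv_mul_cancel_left₀ Real.two_pi_pos.ne']

/-- The integral over a period does not depend on its starting point. This invariance is what
evaluation at `1` lacks. -/
theorem circleMean_comp_mulLeft (g : C(Circle, ℝ)) (w : Circle) :
    circleMean (g.comp (ContinuousMap.mulLeft w)) = circleMean g := by
  obtain ⟨θ, rfl⟩ := Circle.exp_surjective w
  have hper : Function.Periodic (fun t => g (Circle.exp t)) (2 * Real.pi) := fun t => by
    change g (Circle.exp (t + 2 * Real.pi)) = _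
    rw [Circle.exp_add_two_pi]
  have h := hper.intervalIntegral_add_eq θ 0
  rw [zero_add] at h
  rw [circleMean, circleMean, ← h]
  congr 1
  have h2 := intervalIntegral.integral_comp_add_left (fun t => g (Circle.exp t)) θ
    (a := 0) (b := 2 * Real.pi)
  rw [add_zero] at h2
  rw [← h2]
  simp only [Circle.exp_add]
  rfl

instance RotationCircle.instContinuousConstSMul (k : ℤ) :
    ContinuousConstSMul Circle (RotationCircle k) where
  continuous_const_smul w := continuous_const_mul (w ^ k : Circle)

instance FreeLoopSpace.instContinuousConstSMul (X : Type*) [TopologicalSpace X] :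
    ContinuousConstSMul Circle (FreeLoopSpace X) where
  continuous_const_smul w := ContinuousMap.continuous_precomp (ContinuousMap.mulLeft w)

instance WindingLoops.instContinuousConstSMul (k : ℤ) :
    ContinuousConstSMul Circle (WindingLoops k) where
  continuous_const_smul w :=
    ((continuous_const_smul w).comp continuous_subtype_val).subtype_mk _

/-! ### Orbit maps as open quotient maps -/

namespace HomotopyOrbits

variable {G : Type*} [Group G] [TopologicalSpace G] {Y : Type*} [TopologicalSpace Y]
  [MulAction G Y]

/-- The class of a point of `EG × Y` in the homotopy orbits. -/
def mk (G : Type*) [Group G] [TopologicalSpace G] {Y : Type*} [TopologicalSpace Y]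
    [MulAction G Y] (z : MilnorE G × Y) : HomotopyOrbits G Y := Quotient.mk _ z

theorem isOpenQuotientMap_mk [ContinuousMul G] [ContinuousConstSMul G Y] :
    IsOpenQuotientMap (mk G : MilnorE G × Y → HomotopyOrbits G Y) :=
  MulAction.isOpenQuotientMap_quotientMk

theorem mk_eq_mk_iff {p p' : MilnorE G} {y y' : Y} :
    mk G (p, y) = mk G (p', y') ↔ ∃ w : G, w • p' = p ∧ w • y' = y :=
  Quotient.eq.trans (exists_congr fun _ => Prod.ext_iff)

end HomotopyOrbits

namespace ClassifyingSpace

variable {G : Type*} [Group G] [TopologicalSpace G]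

/-- The class of a point of `EG` in `BG`. -/
def mk (G : Type*) [Group G] [TopologicalSpace G] (p : MilnorE G) : ClassifyingSpace G :=
  Quotient.mk _ p

theorem isOpenQuotientMap_mk [ContinuousMul G] : IsOpenQuotientMap (mk G) :=
  MulAction.isOpenQuotientMap_quotientMk

theorem mk_eq_mk_iff {p p' : MilnorE G} : mk G p = mk G p' ↔ ∃ w : G, w • p' = p :=
  Quotient.eq

end ClassifyingSpace

/-! ### Contraction to constant-speed loops -/

section ConstantSpeed

theorem isEmbedding_constantSpeed (k : ℤ) : Topology.IsEmbedding (constantSpeed k) := by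
  have hc : Continuous fun f : WindingLoops k => (show RotationCircle k from f.1 1) :=
    (continuous_eval_const (F := C(Circle, Circle)) (1 : Circle)).comp continuous_subtype_val
  refine Function.LeftInverse.isEmbedding (fun ζ => ?_) hc (constantSpeed k).continuous
  change (show Circle from ζ) * 1 ^ k = ζ
  rw [one_zpow, mul_one]

/-- The universal covering of `X_k`. -/
def rotationExp (k : ℤ) (a : ℝ) : RotationCircle k := Circle.exp a

theorem isOpenQuotientMap_rotationExp (k : ℤ) : IsOpenQuotientMap (rotationExp k) :=
  Circle.isOpenQuotientMap_exp

theorem twistedExpOnto_const (k : ℤ) (a : ℝ) :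
    twistedExpOnto k (ContinuousMap.const _ a) = constantSpeed k (rotationExp k a) :=
  Subtype.ext (ContinuousMap.ext fun z => mul_comm (z ^ k) (Circle.exp a))

/-- The straight-line homotopy from the constant function with value `μ g` to `g`. -/
def contractToConst (μ : C(C(Circle, ℝ), ℝ)) (s : unitInterval) (g : C(Circle, ℝ)) :
    C(Circle, ℝ) :=
  (1 - (s : ℝ)) • ContinuousMap.const _ (μ g) + (s : ℝ) • g

theorem continuous_contractToConst (μ : C(C(Circle, ℝ), ℝ)) :
    Continuous fun z : unitInterval × C(Circle, ℝ) => contractToConst μ z.1 z.2 := by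
  have h : Continuous fun z : unitInterval × C(Circle, ℝ) =>
      (ContinuousMap.const Circle (μ z.2) : C(Circle, ℝ)) :=
    ContinuousMap.continuous_const'.comp (by fun_prop)
  exact ((continuous_const.sub (continuous_subtype_val.comp continuous_fst)).smul h).add
    ((continuous_subtype_val.comp continuous_fst).smul continuous_snd)

theorem contractToConst_zero (μ : C(C(Circle, ℝ), ℝ)) (g : C(Circle, ℝ)) :
    contractToConst μ 0 g = ContinuousMap.const _ (μ g) := by
  simp [contractToConst]

theorem contractToConst_one (μ : C(C(Circle, ℝ), ℝ)) (g : C(Circle, ℝ)) :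
    contractToConst μ 1 g = g := by
  simp [contractToConst]

/-- The contraction inherits every symmetry of `μ`; this is what makes it respect the fibres of the
quotient maps. -/
theorem contractToConst_comp_add_const {μ : C(C(Circle, ℝ), ℝ)} {g : C(Circle, ℝ)}
    {r : C(Circle, Circle)} {c : ℝ} (h : μ (g.comp r + ContinuousMap.const _ c) = μ g + c)
    (s : unitInterval) :
    contractToConst μ s (g.comp r + ContinuousMap.const _ c)
      = (contractToConst μ s g).comp r + ContinuousMap.const _ c := by
  refine ContinuousMap.ext fun z => ?_
  simp only [contractToConst, h, ContinuousMap.add_apply, ContinuousMap.smul_apply,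
    ContinuousMap.comp_apply, ContinuousMap.const_apply, smul_eq_mul]
  ring

theorem exists_homotopyEquiv_constantSpeed (k : ℤ) :
    ∃ h : RotationCircle k ≃ₕ WindingLoops k,
      h.toFun = constantSpeed k ∧ ∀ f : WindingLoops k, h.invFun f = f.1 1 := by
  let φ : C(ℝ, C(Circle, ℝ)) := ⟨ContinuousMap.const _, ContinuousMap.continuous_const'⟩
  let ψ : C(C(Circle, ℝ), ℝ) := ⟨fun g => g 1, continuous_eval_const 1⟩
  have hexp {a b : ℝ} (h : Circle.exp a = Circle.exp b) :
      twistedExpOnto k (φ a) = twistedExpOnto k (φ b) := by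
    change twistedExpOnto k (ContinuousMap.const _ a) = twistedExpOnto k (ContinuousMap.const _ b)
    rw [twistedExpOnto_const, twistedExpOnto_const]
    exact congrArg (constantSpeed k) h
  have hφψ (s : unitInterval) (g h : C(Circle, ℝ)) (hgh : twistedExpOnto k g = twistedExpOnto k h) :
      twistedExpOnto k (contractToConst ψ s g) = twistedExpOnto k (contractToConst ψ s h) := by
    obtain ⟨m, rfl⟩ := twistedExpOnto_eq_iff.1 hgh
    exact twistedExpOnto_eq_iff.2 ⟨m, contractToConst_comp_add_const (r := .id _) rfl s⟩
  obtain ⟨e, he, he'⟩ := exists_homotopyEquiv_of_isOpenQuotientMap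
    (isOpenQuotientMap_rotationExp k) (isOpenQuotientMap_twistedExpOnto k) φ ψ
    (fun a b h => hexp h)
    (fun g h hgh => by
      obtain ⟨m, rfl⟩ := twistedExpOnto_eq_iff.1 hgh
      exact Circle.exp_eq_exp.2 ⟨m, rfl⟩)
    -- A constant function evaluates to its constant, so this composite is the identity on the nose.
    (.refl _ fun a b h => h)
    ⟨⟨⟨⟨_, continuous_contractToConst ψ⟩, contractToConst_zero ψ, contractToConst_one ψ⟩, hφψ⟩⟩
  refine ⟨e, ContinuousMap.ext fun ζ => ?_, fun f => ?_⟩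
  · obtain ⟨a, rfl⟩ := (isOpenQuotientMap_rotationExp k).surjective ζ
    exact (he a).trans (twistedExpOnto_const k a)
  · obtain ⟨g, rfl⟩ := (isOpenQuotientMap_twistedExpOnto k).surjective f
    refine (he' g).trans ?_
    change Circle.exp (g 1) = 1 ^ k * Circle.exp (g 1)
    rw [one_zpow, one_mul]

/-- Taking a real angle `θ` in place of a point of the circle turns the action on `X_k` into
translation by the real number `k * θ`, up to `2πℤ`. -/
theorem HomotopyOrbits.mk_rotationExp_eq_iff {k : ℤ} {p p' : MilnorE Circle} {a a' : ℝ} :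
    HomotopyOrbits.mk Circle (p, rotationExp k a) = .mk Circle (p', rotationExp k a') ↔
      ∃ (θ : ℝ) (m : ℤ), Circle.exp θ • p' = p ∧ a = a' + (k * θ + m * (2 * Real.pi)) := by
  rw [HomotopyOrbits.mk_eq_mk_iff]
  have key (θ : ℝ) : Circle.exp θ • rotationExp k a' = rotationExp k (k * θ + a') := by
    change Circle.exp θ ^ k * Circle.exp a' = Circle.exp (k * θ + a')
    rw [← Circle.exp_zsmul, zsmul_eq_mul, Circle.exp_add]
  constructor
  · rintro ⟨w, hp, hw⟩
    obtain ⟨θ, rfl⟩ := Circle.exp_surjective w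
    rw [key] at hw
    obtain ⟨m, hm⟩ := Circle.exp_eq_exp.1 hw.symm
    exact ⟨θ, m, hp, by rw [hm]; ring⟩
  · rintro ⟨θ, m, hp, rfl⟩
    refine ⟨Circle.exp θ, hp, ?_⟩
    rw [key]
    exact (Circle.exp_eq_exp.2 ⟨m, by ring⟩ : Circle.exp _ = Circle.exp _).symm

theorem HomotopyOrbits.mk_twistedExpOnto_eq_iff {k : ℤ} {p p' : MilnorE Circle}
    {g g' : C(Circle, ℝ)} :
    HomotopyOrbits.mk Circle (p, twistedExpOnto k g) = .mk Circle (p', twistedExpOnto k g') ↔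
      ∃ (θ : ℝ) (m : ℤ), Circle.exp θ • p' = p ∧
        g = g'.comp (ContinuousMap.mulLeft (Circle.exp θ))
          + ContinuousMap.const _ (k * θ + m * (2 * Real.pi)) := by
  rw [HomotopyOrbits.mk_eq_mk_iff, Circle.exp_surjective.exists]
  refine exists_congr fun θ => ?_
  rw [smul_twistedExpOnto, eq_comm (b := twistedExpOnto k g), twistedExpOnto_eq_iff,
    ← exists_and_left]
  refine exists_congr fun m => and_congr_right fun _ => ?_
  rw [add_assoc]
  rfl

/-- Both homotopy orbit spaces are quotients by relations with the same parameters `θ` and `m`. The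
mean carries one relation to the other because it ignores rotations and commutes with adding
constants. -/
theorem exists_homotopyEquiv_map_constantSpeed (k : ℤ) :
    ∃ h : HomotopyOrbits Circle (RotationCircle k) ≃ₕ HomotopyOrbits Circle (WindingLoops k),
      h.toFun = HomotopyOrbits.map (constantSpeed k) (constantSpeed_smul k) := by
  let E := MilnorE Circle
  let μ : C(C(Circle, ℝ), ℝ) := ⟨circleMean, continuous_circleMean⟩
  have hμ (g : C(Circle, ℝ)) (w : Circle) (c : ℝ) :
      μ (g.comp (ContinuousMap.mulLeft w) + ContinuousMap.const _ c) = μ g + c :=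
    (circleMean_add_const _ c).trans (congrArg (· + c) (circleMean_comp_mulLeft g w))
  let φ : C(E × ℝ, E × C(Circle, ℝ)) := ⟨fun z => (z.1, ContinuousMap.const _ z.2),
    continuous_fst.prodMk (ContinuousMap.continuous_const'.comp continuous_snd)⟩
  let ψ : C(E × C(Circle, ℝ), E × ℝ) := ⟨fun z => (z.1, μ z.2), by fun_prop⟩
  let q₁ (z : E × ℝ) : HomotopyOrbits Circle (RotationCircle k) :=
    .mk Circle (z.1, rotationExp k z.2)
  let q₂ (z : E × C(Circle, ℝ)) : HomotopyOrbits Circle (WindingLoops k) :=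
    .mk Circle (z.1, twistedExpOnto k z.2)
  have h₁ : IsOpenQuotientMap q₁ := HomotopyOrbits.isOpenQuotientMap_mk.comp
    (IsOpenQuotientMap.id.prodMap (isOpenQuotientMap_rotationExp k))
  have h₂ : IsOpenQuotientMap q₂ := HomotopyOrbits.isOpenQuotientMap_mk.comp
    (IsOpenQuotientMap.id.prodMap (isOpenQuotientMap_twistedExpOnto k))
  have hψφ : ψ.comp φ = .id _ :=
    ContinuousMap.ext fun z => Prod.ext rfl (circleMean_const z.2)
  have hF : Continuous fun z : unitInterval × (E × C(Circle, ℝ)) =>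
      (z.2.1, contractToConst μ z.1 z.2.2) :=
    (continuous_fst.comp continuous_snd).prodMk ((continuous_contractToConst μ).comp
      (continuous_fst.prodMk (continuous_snd.comp continuous_snd)))
  have hφψ (s : unitInterval) (x y : E × C(Circle, ℝ)) (hxy : q₂ x = q₂ y) :
      q₂ (x.1, contractToConst μ s x.2) = q₂ (y.1, contractToConst μ s y.2) := by
    obtain ⟨θ, m, hp, hg⟩ := HomotopyOrbits.mk_twistedExpOnto_eq_iff.1 hxy
    refine HomotopyOrbits.mk_twistedExpOnto_eq_iff.2 ⟨θ, m, hp, ?_⟩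
    rw [hg]
    exact contractToConst_comp_add_const (hμ _ _ _) s
  obtain ⟨e, he, -⟩ := exists_homotopyEquiv_of_isOpenQuotientMap h₁ h₂ φ ψ
    (fun x y hxy => by
      obtain ⟨θ, m, hp, ha⟩ := HomotopyOrbits.mk_rotationExp_eq_iff.1 hxy
      exact HomotopyOrbits.mk_twistedExpOnto_eq_iff.2
        ⟨θ, m, hp, ContinuousMap.ext fun _ => ha⟩)
    (fun x y hxy => by
      obtain ⟨θ, m, hp, hg⟩ := HomotopyOrbits.mk_twistedExpOnto_eq_iff.1 hxy
      refine HomotopyOrbits.mk_rotationExp_eq_iff.2 ⟨θ, m, hp, ?_⟩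
      exact (congrArg μ hg).trans (hμ _ _ _))
    (by
      rw [hψφ]
      exact .refl _ fun _ _ h => h)
    ⟨⟨⟨⟨_, hF⟩, fun z => Prod.ext rfl (contractToConst_zero μ z.2),
      fun z => Prod.ext rfl (contractToConst_one μ z.2)⟩, hφψ⟩⟩
  refine ⟨e, ContinuousMap.ext fun x => ?_⟩
  obtain ⟨⟨p, a⟩, rfl⟩ := h₁.surjective x
  rw [he]
  exact congrArg (fun f => HomotopyOrbits.mk Circle (p, f)) (twistedExpOnto_const k a)

end ConstantSpeed

/-! ### The case `k = 0` -/

section TrivialAction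

theorem RotationCircle.zero_smul (w : Circle) (ζ : RotationCircle 0) : w • ζ = ζ := by
  change w ^ (0 : ℤ) * (show Circle from ζ) = ζ
  rw [zpow_zero, one_mul]

/-- The homotopy orbits of the trivial action on the circle. -/
theorem exists_homotopyEquiv_rotationCircle_zero :
    Nonempty (HomotopyOrbits Circle (RotationCircle 0) ≃ₕ Circle × ClassifyingSpace Circle) := by
  let q (z : MilnorE Circle × RotationCircle 0) : Circle × ClassifyingSpace Circle :=
    (z.2, .mk Circle z.1)
  have hq : IsOpenQuotientMap q :=
    (IsOpenQuotientMap.id.prodMap ClassifyingSpace.isOpenQuotientMap_mk).comp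
      (Homeomorph.prodComm (MilnorE Circle) Circle).isOpenQuotientMap
  have h (x y : MilnorE Circle × RotationCircle 0) :
      HomotopyOrbits.mk Circle x = .mk Circle y ↔ q x = q y := by
    refine HomotopyOrbits.mk_eq_mk_iff.trans ?_
    refine Iff.trans ?_ (Prod.ext_iff.trans (and_congr_right' ClassifyingSpace.mk_eq_mk_iff)).symm
    simp only [RotationCircle.zero_smul]
    exact ⟨fun ⟨w, h1, h2⟩ => ⟨h2.symm, w, h1⟩, fun ⟨h2, w, h1⟩ => ⟨w, h1, h2.symm⟩⟩
  -- Two open quotient maps with the same fibres: the identity upstairs descends in both directions.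
  obtain ⟨e, -⟩ := exists_homotopyEquiv_of_isOpenQuotientMap
    HomotopyOrbits.isOpenQuotientMap_mk hq (.id _) (.id _)
    (fun x y => (h x y).1) (fun x y => (h x y).2)
    (.refl _ fun _ _ h => h) (.refl _ fun _ _ h => h)
  exact ⟨e⟩

end TrivialAction

/-! ### Comparing `EC` and `ET` for a finite cyclic subgroup `C` of the circle `T` -/

section CyclicGroup

variable (n : ℕ) [NeZero n]

/-- The embedding of the cyclic group of order `n` into the circle. -/
def cyclicToCircle : Multiplicative (ZMod n) →* Circle := ZMod.toCircle.toMonoidHom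

theorem cyclicToCircle_injective : Function.Injective (cyclicToCircle n) :=
  ZMod.injective_toCircle

theorem exists_cyclicToCircle_eq_iff {w : Circle} :
    (∃ a, cyclicToCircle n a = w) ↔ w ^ n = 1 := by
  constructor
  · rintro ⟨a, rfl⟩
    rw [← map_pow]
    have : a ^ n = 1 := by
      rw [← ofAdd_toAdd a, ← ofAdd_nsmul, nsmul_eq_mul, CharP.cast_eq_zero, zero_mul, ofAdd_zero]
    rw [this, map_one]
  · intro h
    obtain ⟨θ, rfl⟩ := Circle.exp_surjective w
    rw [← Circle.exp_nsmul, Circle.exp_eq_one] at h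
    obtain ⟨m, hm⟩ := h
    refine ⟨Multiplicative.ofAdd (m : ZMod n), ?_⟩
    have hn : (n : ℝ) ≠ 0 := NeZero.ne _
    have hθ : θ = 2 * Real.pi * (m / n) := by
      rw [nsmul_eq_mul] at hm
      field_simp
      linarith
    change ZMod.toCircle (m : ZMod n) = _
    refine Circle.ext ?_
    rw [ZMod.toCircle_intCast, hθ, Circle.coe_exp]
    push_cast
    congr 1
    ring

variable {n}

/-- A branch of the `n`-th root trivializes the covering `z ↦ zⁿ` of the circle equivariantly. -/
theorem exists_cyclic_trivialization {ℓ : Circle → Circle} (hℓ : ∀ v, ℓ v ^ n = v)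
    {S : Set Circle} (hS : IsOpen S) (hc : ContinuousOn ℓ S) :
    ∃ c : Circle → Multiplicative (ZMod n),
      (∀ a z, c (cyclicToCircle n a * z) = a * c z) ∧
      ∀ U : Set (Multiplicative (ZMod n)), IsOpen {z | z ^ n ∈ S ∧ c z ∈ U} := by
  -- The discrepancy between `z` and the chosen root of `z ^ n` is an `n`-th root of unity: the
  -- fibre coordinate of the covering.
  have hex (z : Circle) : ∃ a, cyclicToCircle n a = z / ℓ (z ^ n) := by
    rw [exists_cyclicToCircle_eq_iff, div_pow, hℓ, div_self']
  choose c hc' using hex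
  refine ⟨c, fun a z => cyclicToCircle_injective n ?_, fun U => isOpen_iff_mem_nhds.2 ?_⟩
  · have ha : cyclicToCircle n a ^ n = 1 := (exists_cyclicToCircle_eq_iff n).1 ⟨a, rfl⟩
    rw [hc', map_mul, hc', mul_pow, ha, one_mul, mul_div_assoc]
  · rintro z₀ ⟨hz₀, hU⟩
    have hcont : ContinuousAt (fun z => z / ℓ (z ^ n)) z₀ :=
      continuousAt_id.div' ((hc.continuousAt (hS.mem_nhds hz₀)).comp (f := fun z : Circle => z ^ n)
        (by fun_prop))
    -- Near `z₀` the discrepancy avoids the finitely many other roots of unity, so `c` is locally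
    -- constant.
    have hfin : (cyclicToCircle n '' {c z₀}ᶜ).Finite := Set.toFinite _
    have hmem : z₀ / ℓ (z₀ ^ n) ∈ (cyclicToCircle n '' {c z₀}ᶜ)ᶜ := by
      rintro ⟨a, ha, h⟩
      exact ha (cyclicToCircle_injective n (h.trans (hc' z₀).symm))
    filter_upwards [(hS.preimage (continuous_pow n)).mem_nhds hz₀,
      hcont.preimage_mem_nhds (hfin.isClosed.isOpen_compl.mem_nhds hmem)] with z hz hz'
    refine ⟨hz, ?_⟩
    have : c z = c z₀ := by
      by_contra hne
      exact hz' ⟨c z, hne, hc' z⟩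
    rwa [this]

theorem Circle.coe_exp_pi : (Circle.exp Real.pi : ℂ) = -1 := by
  rw [Circle.coe_exp, Complex.exp_pi_mul_I]

variable (n) in
/-- The principal branch of the `n`-th root on the circle. -/
def circleRoot (v : Circle) : Circle := Circle.exp ((v : ℂ).arg / n)

theorem circleRoot_pow (v : Circle) : circleRoot n v ^ n = v := by
  have hn : (n : ℝ) ≠ 0 := NeZero.ne _
  rw [circleRoot, ← Circle.exp_nsmul, nsmul_eq_mul, mul_div_cancel₀ _ hn, Circle.exp_arg]

omit [NeZero n] in
theorem continuousOn_circleRoot :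
    ContinuousOn (circleRoot n) {v : Circle | 1 + (v : ℂ).re ≠ 0} := by
  refine fun v hv => ContinuousAt.continuousWithinAt ?_
  have hs : (v : ℂ) ∈ Complex.slitPlane := by
    rw [Complex.mem_slitPlane_iff]
    by_contra! h
    have h1 := Circle.normSq_coe v
    rw [Complex.normSq_apply, h.2] at h1
    have h2 : ((v : ℂ).re - 1) * (1 + (v : ℂ).re) = 0 := by linarith
    rcases mul_eq_zero.1 h2 with h3 | h3
    · linarith [h.1]
    · exact hv h3
  exact Circle.exp.continuous.continuousAt.comp
    (((Complex.continuousAt_arg hs).comp (f := fun v : Circle => (v : ℂ)) (by fun_prop)).div_const _)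

/-- For the cyclic group `C` of order `n` in the circle `T` there are `C`-equivariant maps
`EC → ET` and `ET → EC`. -/
theorem exists_equivariant_maps_milnorE :
    ∃ (φ : C(MilnorE (Multiplicative (ZMod n)), MilnorE Circle))
      (ψ : C(MilnorE Circle, MilnorE (Multiplicative (ZMod n)))),
      (∀ a p, φ (a • p) = cyclicToCircle n a • φ p) ∧
      (∀ a p, ψ (cyclicToCircle n a • p) = a • ψ p) := by
  have hre (z : Circle) : |(z : ℂ).re| ≤ 1 := (Complex.abs_re_le_norm z).trans z.norm_coe.le
  -- `u` vanishes exactly where `z ^ n = -1` and `v` exactly where `z ^ n = 1`: the points where the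
  -- two branches of the root below may break. Depending on `z ^ n` alone makes both invariant under
  -- `C`.
  let u (z : Circle) : ℝ := (1 + ((z ^ n : Circle) : ℂ).re) / 2
  let v (z : Circle) : ℝ := (1 - ((z ^ n : Circle) : ℂ).re) / 2
  have hu (z : Circle) : 0 ≤ u z := by
    have := (abs_le.1 (hre (z ^ n))).1
    simp only [u]
    linarith
  have hv (z : Circle) : 0 ≤ v z := by
    have := (abs_le.1 (hre (z ^ n))).2
    simp only [v]
    linarith
  have huv (z : Circle) : u z + v z = 1 := by
    simp only [u, v]
    ring
  have huc : Continuous u := by fun_prop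
  have hvc : Continuous v := by fun_prop
  have hpow (a : Multiplicative (ZMod n)) (z : Circle) : (cyclicToCircle n a * z) ^ n = z ^ n := by
    rw [mul_pow, (exists_cyclicToCircle_eq_iff n).1 ⟨a, rfl⟩, one_mul]
  obtain ⟨c, hc, hcU⟩ := exists_cyclic_trivialization (circleRoot_pow (n := n))
    (isOpen_ne_fun (by fun_prop) continuous_const) continuousOn_circleRoot
  have hflip (z : Circle) : ((z * Circle.exp Real.pi : Circle) : ℂ).re = -(z : ℂ).re := by
    rw [Circle.coe_mul, Circle.coe_exp_pi, mul_neg_one, Complex.neg_re]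
  obtain ⟨d, hd, hdU⟩ := exists_cyclic_trivialization (n := n)
    -- A root of `-z` times a root of `-1` is a root of `z`; this branch is continuous away from
    -- `1`.
    (ℓ := fun z => circleRoot n (z * Circle.exp Real.pi) * circleRoot n (Circle.exp Real.pi))
    (S := {z : Circle | 1 - (z : ℂ).re ≠ 0})
    (fun z => by
      rw [mul_pow, circleRoot_pow, circleRoot_pow, mul_assoc, ← Circle.exp_add, ← two_mul,
        Circle.exp_two_pi, mul_one])
    (isOpen_ne_fun (by fun_prop) continuous_const)
    ((continuousOn_circleRoot.comp (f := fun z : Circle => z * Circle.exp Real.pi)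
      (by fun_prop) fun z hz => by
        change 1 + ((z * Circle.exp Real.pi : Circle) : ℂ).re ≠ 0
        rw [hflip, ← sub_eq_add_neg]
        exact hz).mul continuousOn_const)
  refine ⟨⟨MilnorE.map (cyclicToCircle n), MilnorE.continuous_map continuous_of_discreteTopology⟩,
    ⟨MilnorE.split u v hu hv huv c d, MilnorE.continuous_split huc hvc (fun U _ => ?_)
      fun U _ => ?_⟩, MilnorE.map_smul _, fun a => MilnorE.split_smul (huv := huv) (fun z => ?_) (fun z => ?_)
      (hc a) (hd a)⟩
  · convert hcU U using 4
    exact (div_ne_zero_iff.trans (and_iff_left two_ne_zero))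
  · convert hdU U using 4
    exact (div_ne_zero_iff.trans (and_iff_left two_ne_zero))
  · simp only [u, hpow]
  · simp only [v, hpow]

end CyclicGroup

/-! ### The case `k ≠ 0` -/

section RotationCircle

variable {k : ℤ}

/-- The action on `X_k` is transitive, so every class has a representative over `1`. For openness,
precompose with the projection from `ET × T`: since `[p, 1] = [w p, w ^ k]`, the result is a shear
homeomorphism followed by the power covering and the orbit map. -/
theorem isOpenQuotientMap_mk_one (hk : k ≠ 0) : IsOpenQuotientMap fun p : MilnorE Circle =>
    HomotopyOrbits.mk Circle (p, (show RotationCircle k from (1 : Circle))) := by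
  have : NeZero k := ⟨hk⟩
  let e : MilnorE Circle × Circle ≃ₜ MilnorE Circle × Circle :=
    { toFun := fun z => (z.2 • z.1, z.2)
      invFun := fun z => (z.2⁻¹ • z.1, z.2)
      left_inv := fun z => by simp
      right_inv := fun z => by simp }
  have hpow : IsOpenQuotientMap fun w : Circle => (show RotationCircle k from w ^ k) :=
    ⟨(Circle.isQuotientCoveringMap_zpow k).surjective,
      continuous_zpow k, (Circle.isQuotientCoveringMap_zpow k).isCoveringMap.isOpenMap⟩
  have hm := (HomotopyOrbits.isOpenQuotientMap_mk (G := Circle)).comp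
    ((IsOpenQuotientMap.id.prodMap hpow).comp e.isOpenQuotientMap)
  refine IsOpenQuotientMap.of_comp (f := Prod.fst) (X := MilnorE Circle × Circle)
    continuous_fst Prod.fst_surjective ?_ ?_
  · exact HomotopyOrbits.isOpenQuotientMap_mk.continuous.comp
      (continuous_id.prodMk continuous_const)
  · convert hm using 1
    funext z
    refine (HomotopyOrbits.mk_eq_mk_iff.2 ⟨z.2, rfl, ?_⟩).symm
    exact mul_one (z.2 ^ k)

/-- The stabilizer of `1` in `X_k` is the group of `|k|`-th roots of unity. -/
theorem HomotopyOrbits.mk_one_eq_iff (hk : k ≠ 0) {p p' : MilnorE Circle} :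
    haveI : NeZero k.natAbs := ⟨Int.natAbs_ne_zero.2 hk⟩
    HomotopyOrbits.mk Circle (p, (show RotationCircle k from (1 : Circle))) =
      .mk Circle (p', (show RotationCircle k from (1 : Circle))) ↔
    ∃ a, cyclicToCircle k.natAbs a • p' = p := by
  have : NeZero k.natAbs := ⟨Int.natAbs_ne_zero.2 hk⟩
  have hw (w : Circle) : w • (show RotationCircle k from (1 : Circle)) = (1 : Circle) ↔
      ∃ a, cyclicToCircle k.natAbs a = w := by
    rw [exists_cyclicToCircle_eq_iff, pow_natAbs_eq_one]
    change w ^ k * 1 = 1 ↔ _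
    rw [mul_one]
  rw [HomotopyOrbits.mk_eq_mk_iff]
  constructor
  · rintro ⟨w, hp, h⟩
    obtain ⟨a, rfl⟩ := (hw w).1 h
    exact ⟨a, hp⟩
  · rintro ⟨a, hp⟩
    exact ⟨_, hp, (hw _).2 ⟨a, rfl⟩⟩

/-- The homotopy orbits of the `k`-fold rotation action on the circle. -/
theorem exists_homotopyEquiv_rotationCircle (hk : k ≠ 0) :
    Nonempty (HomotopyOrbits Circle (RotationCircle k) ≃ₕ
      ClassifyingSpace (Multiplicative (ZMod k.natAbs))) := by
  have : NeZero k.natAbs := ⟨Int.natAbs_ne_zero.2 hk⟩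
  obtain ⟨φ, ψ, hφ, hψ⟩ := exists_equivariant_maps_milnorE (n := k.natAbs)
  obtain ⟨e, -⟩ := exists_homotopyEquiv_of_isOpenQuotientMap (isOpenQuotientMap_mk_one hk)
    (ClassifyingSpace.isOpenQuotientMap_mk (G := Multiplicative (ZMod k.natAbs))) ψ φ
    (fun x y h => by
      obtain ⟨a, rfl⟩ := (HomotopyOrbits.mk_one_eq_iff hk).1 h
      exact ClassifyingSpace.mk_eq_mk_iff.2 ⟨a, (hψ a y).symm⟩)
    (fun x y h => by
      obtain ⟨a, rfl⟩ := ClassifyingSpace.mk_eq_mk_iff.1 h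
      exact (HomotopyOrbits.mk_one_eq_iff hk).2 ⟨a, (hφ a y).symm⟩)
    (by
      -- Equivariance is available only for the cyclic subgroup, acting on `ET` through its
      -- inclusion in the circle.
      obtain ⟨F⟩ := MilnorE.homotopicWith_of_equivariant (f₀ := φ.comp ψ) (f₁ := .id _)
        (A := fun a p => cyclicToCircle k.natAbs a • p) (B := cyclicToCircle k.natAbs)
        (fun a p => (congrArg φ (hψ a p)).trans (hφ a _)) (fun _ _ => rfl)
      refine ⟨⟨F.toHomotopy, fun s x y h => ?_⟩⟩
      obtain ⟨a, rfl⟩ := (HomotopyOrbits.mk_one_eq_iff hk).1 h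
      exact (HomotopyOrbits.mk_one_eq_iff hk).2 ⟨a, (F.prop s a y).symm⟩)
    (by
      obtain ⟨F⟩ := MilnorE.homotopicWith_of_equivariant (f₀ := ψ.comp φ) (f₁ := .id _)
        (A := fun a p => a • p) (B := id)
        (fun a p => (congrArg ψ (hφ a p)).trans (hψ a _)) (fun _ _ => rfl)
      refine ⟨⟨F.toHomotopy, fun s x y h => ?_⟩⟩
      obtain ⟨a, rfl⟩ := ClassifyingSpace.mk_eq_mk_iff.1 h
      exact ClassifyingSpace.mk_eq_mk_iff.2 ⟨a, (F.prop s a y).symm⟩)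
  exact ⟨e⟩

end RotationCircle

/-! ### Splitting the homotopy orbits by winding number -/

section Decomposition

/-- The map of homotopy orbits induced by the inclusion of the loops of winding number `k`. -/
def windingInclusion (k : ℤ) :
    C(HomotopyOrbits Circle (WindingLoops k), HomotopyOrbits Circle (FreeLoopSpace Circle)) :=
  HomotopyOrbits.map ⟨Subtype.val, continuous_subtype_val⟩ fun _ _ => rfl

theorem windingInclusion_mk (k : ℤ) (p : MilnorE Circle) (f : WindingLoops k) :
    windingInclusion k (.mk Circle (p, f)) = .mk Circle (p, f.1) := rfl

theorem isOpenMap_windingInclusion (k : ℤ) : IsOpenMap (windingInclusion k) := by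
  rw [HomotopyOrbits.isOpenQuotientMap_mk.isOpenMap_iff]
  exact HomotopyOrbits.isOpenQuotientMap_mk.isOpenMap.comp
    (IsOpenMap.id.prodMap (isOpen_setOf_hasWindingNumber k).isOpenMap_subtype_val)

theorem windingInclusion_injective (k : ℤ) : Function.Injective (windingInclusion k) := by
  intro x y h
  obtain ⟨⟨p, f⟩, rfl⟩ := HomotopyOrbits.isOpenQuotientMap_mk.surjective x
  obtain ⟨⟨p', f'⟩, rfl⟩ := HomotopyOrbits.isOpenQuotientMap_mk.surjective y
  rw [windingInclusion_mk, windingInclusion_mk, HomotopyOrbits.mk_eq_mk_iff] at h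
  obtain ⟨w, hp, hf⟩ := h
  exact HomotopyOrbits.mk_eq_mk_iff.2 ⟨w, hp, Subtype.ext hf⟩

/-- Loops in one orbit differ by a rotation, which preserves the winding number. -/
theorem eq_of_windingInclusion_eq {k l : ℤ} {x : HomotopyOrbits Circle (WindingLoops k)}
    {y : HomotopyOrbits Circle (WindingLoops l)}
    (h : windingInclusion k x = windingInclusion l y) : k = l := by
  obtain ⟨⟨p, f⟩, rfl⟩ := HomotopyOrbits.isOpenQuotientMap_mk.surjective x
  obtain ⟨⟨p', f'⟩, rfl⟩ := HomotopyOrbits.isOpenQuotientMap_mk.surjective y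
  rw [windingInclusion_mk, windingInclusion_mk, HomotopyOrbits.mk_eq_mk_iff] at h
  obtain ⟨w, -, hf⟩ := h
  exact (existsUnique_hasWindingNumber f.1).unique f.2 (hf ▸ f'.2.smul w)

/-- The map to the homotopy orbits of the free loop space from the disjoint union of the homotopy
orbits of the spaces of loops of a given winding number. -/
def windingSum : HomotopyOrbits Circle (WindingLoops 0) ⊕
      (Σ k : {k : ℤ // k ≠ 0}, HomotopyOrbits Circle (WindingLoops k.1)) →
    HomotopyOrbits Circle (FreeLoopSpace Circle) :=
  Sum.elim (windingInclusion 0) fun x => windingInclusion x.1.1 x.2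

theorem continuous_windingSum : Continuous windingSum :=
  (windingInclusion 0).continuous.sumElim
    (continuous_sigma fun k => (windingInclusion k.1).continuous)

theorem isOpenMap_windingSum : IsOpenMap windingSum :=
  isOpenMap_sum.2 ⟨isOpenMap_windingInclusion 0,
    isOpenMap_sigma.2 fun k => isOpenMap_windingInclusion k.1⟩

theorem windingSum_bijective : Function.Bijective windingSum := by
  constructor
  · refine (windingInclusion_injective 0).sumElim ?_ fun x y h =>
      y.1.2 (eq_of_windingInclusion_eq h).symm
    rintro ⟨⟨k, hk⟩, x⟩ ⟨⟨l, hl⟩, y⟩ h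
    obtain rfl : k = l := eq_of_windingInclusion_eq h
    obtain rfl : x = y := windingInclusion_injective k h
    rfl
  · intro z
    obtain ⟨⟨p, f⟩, rfl⟩ := HomotopyOrbits.isOpenQuotientMap_mk.surjective z
    obtain ⟨k, hk, -⟩ := existsUnique_hasWindingNumber f
    by_cases h0 : k = 0
    · subst h0
      exact ⟨Sum.inl (.mk Circle (p, ⟨f, hk⟩)), rfl⟩
    · exact ⟨Sum.inr ⟨⟨k, h0⟩, .mk Circle (p, ⟨f, hk⟩)⟩, rfl⟩

/-- The homotopy orbits of the free loop space of the circle are the disjoint union of the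
homotopy orbits of the spaces of loops of a given winding number. -/
def windingDecomposition : HomotopyOrbits Circle (WindingLoops 0) ⊕
      (Σ k : {k : ℤ // k ≠ 0}, HomotopyOrbits Circle (WindingLoops k.1)) ≃ₜ
    HomotopyOrbits Circle (FreeLoopSpace Circle) :=
  (Equiv.ofBijective windingSum windingSum_bijective).toHomeomorphOfContinuousOpen
    continuous_windingSum isOpenMap_windingSum

theorem windingDecomposition_symm_mk_zero (p : MilnorE Circle) (f : WindingLoops 0) :
    windingDecomposition.symm (HomotopyOrbits.mk Circle (p, f.1)) = Sum.inl (HomotopyOrbits.mk Circle (p, f)) :=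
  windingDecomposition.symm_apply_eq.2 rfl

theorem windingDecomposition_symm_mk {k : ℤ} (hk : k ≠ 0) (p : MilnorE Circle)
    (f : WindingLoops k) :
    windingDecomposition.symm (HomotopyOrbits.mk Circle (p, f.1)) = Sum.inr ⟨⟨k, hk⟩, HomotopyOrbits.mk Circle (p, f)⟩ :=
  windingDecomposition.symm_apply_eq.2 rfl

end Decomposition

end

theorem mainTheorem6 :
    -- winding numbers exist, are unique, and their level sets are the connected components
    (∀ f : FreeLoopSpace Circle, ∃! k : ℤ, HasWindingNumber f k) ∧
    (∀ (k : ℤ) (f : FreeLoopSpace Circle), HasWindingNumber f k →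
      connectedComponent f = {g : FreeLoopSpace Circle | HasWindingNumber g k}) ∧
    -- the equivariant map `ι_k : X_k → Mapᵏ(S¹, S¹)` is an embedding and a homotopy equivalence
    -- with inverse the evaluation at `1`, and it induces an equivalence on homotopy orbits
    (∀ k : ℤ,
      Topology.IsEmbedding (constantSpeed k) ∧
      (∀ (w : Circle) (ζ : RotationCircle k),
        constantSpeed k (w • ζ) = w • constantSpeed k ζ) ∧
      (∃ h : RotationCircle k ≃ₕ WindingLoops k,
        h.toFun = constantSpeed k ∧ ∀ f : WindingLoops k, h.invFun f = f.1 1) ∧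
      (∃ h : HomotopyOrbits Circle (RotationCircle k) ≃ₕ HomotopyOrbits Circle (WindingLoops k),
        h.toFun = HomotopyOrbits.map (constantSpeed k) (constantSpeed_smul k))) ∧
    -- the decomposition of the homotopy orbits, compatible with winding numbers
    (∃ e : HomotopyOrbits Circle (FreeLoopSpace Circle) ≃ₕ
        (Circle × ClassifyingSpace Circle) ⊕
          (Σ k : {k : ℤ // k ≠ 0}, ClassifyingSpace (Multiplicative (ZMod k.1.natAbs))),
      ∀ (x : MilnorE Circle) (f : FreeLoopSpace Circle),
        (HasWindingNumber f 0 → ∃ y, e.toFun (Quotient.mk _ (x, f)) = Sum.inl y) ∧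
        (∀ (k : ℤ) (hk : k ≠ 0), HasWindingNumber f k →
          ∃ y, e.toFun (Quotient.mk _ (x, f)) = Sum.inr ⟨⟨k, hk⟩, y⟩)) := by
  refine ⟨existsUnique_hasWindingNumber,
    fun k f => connectedComponent_eq_setOf_hasWindingNumber,
    fun k => ⟨isEmbedding_constantSpeed k, constantSpeed_smul k,
      exists_homotopyEquiv_constantSpeed k, exists_homotopyEquiv_map_constantSpeed k⟩, ?_⟩
  choose ι _ using exists_homotopyEquiv_map_constantSpeed
  obtain ⟨e₀⟩ := exists_homotopyEquiv_rotationCircle_zero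
  have h (k : {k : ℤ // k ≠ 0}) := exists_homotopyEquiv_rotationCircle k.2
  let E := (ι 0).symm.trans e₀
  let F (k : {k : ℤ // k ≠ 0}) := (ι k.1).symm.trans (h k).some
  refine ⟨windingDecomposition.symm.toHomotopyEquiv.trans
    (E.sumCongr (ContinuousMap.HomotopyEquiv.sigmaCongr F)), fun x f => ⟨fun hf => ?_,
      fun k hk hf => ?_⟩⟩
  · exact ⟨_, congrArg (E.sumCongr (.sigmaCongr F)).toFun
      (windingDecomposition_symm_mk_zero x ⟨f, hf⟩)⟩
  · exact ⟨_, congrArg (E.sumCongr (.sigmaCongr F)).toFun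
      (windingDecomposition_symm_mk hk x ⟨f, hf⟩)⟩
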